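/- Let $d\ge 1$, let $\mathbb S^{d-1}$ be the unit sphere of $\mathbb R^d$, let $0<s\le 2$ and $k\ge 2$. For a kernel $K:(\mathbb S^{d-1})^k\to\mathbb R$, the discrete $k$-input energy of a configuration (multiset) $\omega=\{z_1,\dots,z_{d+1}\}$ of $N=d+1$ points of $\mathbb S^{d-1}$ is $$E_K(\omega)=\frac1{N^k}\sum_{j_1=1}^{N}\cdots\sum_{j_k=1}^{N}K(z_{j_1},\dots,z_{j_k}).$$ Let $V(x_1,\dots,x_k)$ be the $k$-dimensional volume of the parallelepiped spanned by the vectors $x_1,\dots,x_k$, and let $A(x_1,\dots,x_k)$ be the $(k-1)$-dimensional volume of the simplex with vertices $x_1,\dots,x_k$. By a regular simplex we mean a regular $d$-dimensional simplex inscribed in $\mathbb S^{d-1}$; such simplices exist. (a) Let $2\le k\le d$. A configuration of $d+1$ points maximizes $E_{V^s}$ over all $(d+1)$-point configurations on $\mathbb S^{d-1}$ if and only if it is obtained from the set of vertices of a regular simplex by replacing some (possibly none) of the vertices $x$ by their opposites $-x$. Any two maximizers agree up to a rotation and up to replacing individual points by their opposites. (b) Let $2\le k\le d+1$. The vertices of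 every regular simplex maximize $E_{A^s}$ over all $(d+1)$-point configurations on $\mathbb S^{d-1}$. If moreover $s<2$ or $k\ge 3$ or $d\le 2$ (that is, except for $k=s=2$, $d\ge3$), then every maximizer is the set of vertices of a regular simplex, and any two maximizers agree up to a rotation. -/

import Mathlib

namespace SimplexEnergy

/-- The unit sphere of `ℝ^d`, that is, the `(d-1)`-dimensional sphere, with the Euclidean norm. -/
abbrev Sph (d : ℕ) : Type := Metric.sphere (0 : EuclideanSpace ℝ (Fin d)) 1

/-- The discrete energy of an `N`-point configuration `z` (repetitions allowed) with respect to a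
`k`-input kernel `K`: the sum of `K` over all `k`-tuples of indices, divided by `N ^ k`. -/
noncomputable def discreteEnergy {Ω : Type*} {N k : ℕ} (K : (Fin k → Ω) → ℝ)
    (z : Fin N → Ω) : ℝ :=
  (1 / (N : ℝ) ^ k) * ∑ j : Fin k → Fin N, K (fun i => z (j i))

/-- The `k`-dimensional Euclidean volume of the parallelepiped spanned by the vectors
`x 0, …, x (k-1)`. The measure is the `k`-dimensional Hausdorff measure, normalized so that it is
Lebesgue measure on `k`-dimensional Euclidean spaces. -/
noncomputable def volV {d k : ℕ} (x : Fin k → Sph d) : ℝ :=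
  (MeasureTheory.Measure.euclideanHausdorffMeasure k
    (parallelepiped (fun i => (x i : EuclideanSpace ℝ (Fin d))))).toReal

/-- The `(k-1)`-dimensional Euclidean volume of the simplex with vertices `x 0, …, x (k-1)`
(used for `1 ≤ k`). -/
noncomputable def volA {d k : ℕ} (x : Fin k → Sph d) : ℝ :=
  (MeasureTheory.Measure.euclideanHausdorffMeasure (k - 1)
    (convexHull ℝ (Set.range (fun i => (x i : EuclideanSpace ℝ (Fin d)))))).toReal

/-- The discrete energy with kernel `V ^ s`, with `k` inputs. -/
noncomputable def energyV {d N : ℕ} (k : ℕ) (s : ℝ) (z : Fin N → Sph d) : ℝ :=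
  discreteEnergy (fun x : Fin k → Sph d => volV x ^ s) z

/-- The discrete energy with kernel `A ^ s`, with `k` inputs. -/
noncomputable def energyA {d N : ℕ} (k : ℕ) (s : ℝ) (z : Fin N → Sph d) : ℝ :=
  discreteEnergy (fun x : Fin k → Sph d => volA x ^ s) z

/-- The `d + 1` points `z` of the unit sphere of `ℝ^d` are the vertices of a regular simplex:
they are affinely independent, and all edges have the same length. -/
def IsRegularSimplex {d : ℕ} (z : Fin (d + 1) → Sph d) : Prop :=
  ∃ S : Affine.Simplex ℝ (EuclideanSpace ℝ (Fin d)) d,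
    S.Equilateral ∧ ∀ i, S.points i = (z i : EuclideanSpace ℝ (Fin d))

/-- `R` is a rotation of `ℝ^d`: a linear isometry with determinant one. -/
def IsRotation {d : ℕ} (R : EuclideanSpace ℝ (Fin d) ≃ₗᵢ[ℝ] EuclideanSpace ℝ (Fin d)) : Prop :=
  LinearMap.det (R.toLinearEquiv : EuclideanSpace ℝ (Fin d) →ₗ[ℝ] EuclideanSpace ℝ (Fin d)) = 1

/-- Two configurations agree, as multisets, up to a rotation. -/
def EqUpToRotation {d N : ℕ} (z w : Fin N → Sph d) : Prop :=
  ∃ R : EuclideanSpace ℝ (Fin d) ≃ₗᵢ[ℝ] EuclideanSpace ℝ (Fin d), IsRotation R ∧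
    ∃ π : Equiv.Perm (Fin N), ∀ i,
      (z i : EuclideanSpace ℝ (Fin d)) = R (w (π i) : EuclideanSpace ℝ (Fin d))

/-- `z` is obtained from `w` by replacing some (possibly none or all) of the points by
their opposites. -/
def EqUpToSigns {d N : ℕ} (z w : Fin N → Sph d) : Prop :=
  ∀ i, z i = w i ∨ z i = - w i

/-- Two configurations agree, as multisets, up to a rotation and replacing individual
points by their opposites. -/
def EqUpToRotationAndSigns {d N : ℕ} (z w : Fin N → Sph d) : Prop :=
  ∃ z' : Fin N → Sph d, EqUpToSigns z z' ∧ EqUpToRotation z' w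

end SimplexEnergy

/-!
Squared volumes of parallelepipeds and simplices are Gram determinants, up to a constant factor
that depends only on the number of points (`volV_eq`, `volA_eq`). So both energies are sums of the
powers `a ^ (s / 2)` of Gram determinants `a`, over injective tuples of indices. All these
determinants agree for the vertices of a regular simplex. Since `t ↦ t ^ (s / 2)` is concave, it
suffices to maximize the sum of the determinants themselves (`isMaxOn_of_forall_eq`,
`sum_eq_of_isMaxOn`).

For the kernel `V`, this sum is a sum of principal minors of the Gram matrix `Y Yᵀ` of the points,
and it does not change when `Y Yᵀ` is replaced by the frame operator `Yᵀ Y`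
(`minorSum_mul_comm`). There it is `k!` times an elementary symmetric polynomial of `d`
nonnegative eigenvalues with sum `d + 1`, and Maclaurin's inequality gives the maximum
(`injSum_le`). Equality forces the frame operator to be a multiple of the identity
(`eq_mean_of_le_injSum`). Then `1 - (d / (d + 1)) Y Yᵀ` is a projection with constant diagonal
`1 / (d + 1)`, hence a matrix of signs up to scaling (`exists_signs_of_idempotent`), and after
replacing some points by their opposites all inner products are `-1 / d`.

For the kernel `A`, the sum of the determinants of differences is a multiple of the sum of principal
minors, of order one less, of the Gram matrix of the points translated by their center of mass
(`sum_det_diffMatrix`). The translation decreases the trace unless the center of mass is the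
origin. So equality forces the sum of the points to be zero. For `3 ≤ k` it also forces the frame
operator to be a multiple of the identity, and the vanishing sum excludes sign changes. For `k = 2`
and `s < 2` all distances agree, by strict concavity. For `k = 2` and `d ≤ 2` the vanishing sum
determines all the inner products.

Finally, two regular simplices are related by an isometry, since their Gram matrices agree. A
reflection that exchanges two vertices makes it a rotation (`HasSimplexGram.eqUpToRotation`).
-/

namespace SimplexEnergy

open Finset

/-! ### Sums over injective tuples and Maclaurin's inequality -/

section Maclaurin

/-- The sum of `∏ r, x (e r)` over all injective `k`-tuples `e` of indices. This is `k!` times the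
`k`-th elementary symmetric polynomial of the numbers `x i`. -/
noncomputable def injSum {ι : Type*} [Fintype ι] (k : ℕ) (x : ι → ℝ) : ℝ :=
  ∑ e : Fin k ↪ ι, ∏ r, x (e r)

lemma sum_eq_sum_embedding {ι M : Type*} [Fintype ι] [AddCommMonoid M] {k : ℕ}
    (f : (Fin k → ι) → M) (hf : ∀ j, ¬ Function.Injective j → f j = 0) :
    ∑ j, f j = ∑ e : Fin k ↪ ι, f e := by
  classical
  rw [← Finset.sum_filter_of_ne (p := Function.Injective)
    (fun j _ h => by by_contra hj; exact h (hf j hj))]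
  refine (Finset.sum_bij (fun (e : Fin k ↪ ι) _ => ⇑e) ?_ ?_ ?_ ?_).symm
  · intro e _; simpa using e.injective
  · intro e _ e' _ h; exact DFunLike.coe_injective h
  · intro j hj; exact ⟨⟨j, by simpa using hj⟩, by simp, rfl⟩
  · intro e _; rfl

variable {ι : Type*} [Fintype ι]

lemma sum_embedding_succ {k : ℕ} (F : (Fin (k + 1) → ι) → ℝ) [DecidableEq ι] :
    ∑ e : Fin (k + 1) ↪ ι, F e =
      ∑ e : Fin k ↪ ι, ∑ m ∈ (univ.map e)ᶜ, F (Fin.cons m e) := by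
  classical
  rw [← Equiv.sum_comp (Equiv.embeddingFinSucc k ι).symm, Fintype.sum_sigma]
  refine Finset.sum_congr rfl fun e _ => ?_
  simp only [Equiv.coe_embeddingFinSucc_symm]
  refine Finset.sum_bij (fun m _ => m.1) ?_ ?_ ?_ ?_
  · rintro ⟨m, hm⟩ _; simpa using hm
  · rintro ⟨m, hm⟩ _ ⟨m', hm'⟩ _ h; exact Subtype.ext h
  · intro m hm; exact ⟨⟨m, by simpa using hm⟩, by simp, rfl⟩
  · rintro ⟨m, hm⟩ _; rfl

lemma sum_embedding_comp_perm {k : ℕ} (σ : Equiv.Perm (Fin k)) (F : (Fin k → ι) → ℝ) :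
    ∑ e : Fin k ↪ ι, F (fun r => e (σ r)) = ∑ e : Fin k ↪ ι, F e :=
  Fintype.sum_equiv (Equiv.embeddingCongr σ.symm (Equiv.refl ι)) _ _ fun e => by
    congr 1

lemma injSum_zero (x : ι → ℝ) : injSum 0 x = 1 := by
  simp [injSum]

lemma injSum_one (x : ι → ℝ) : injSum 1 x = ∑ i, x i := by
  classical
  rw [injSum, sum_embedding_succ (fun e => ∏ r, x (e r))]
  simp

lemma injSum_const (k : ℕ) (c : ℝ) :
    injSum k (fun _ : ι => c) = (Fintype.card ι).descFactorial k * c ^ k := by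
  simp [injSum, Fintype.card_embedding_eq]

/-- The sum over injective `(k + 1)`-tuples in which the first factor is squared. -/
noncomputable def injSumSq (k : ℕ) (x : ι → ℝ) : ℝ :=
  ∑ e : Fin (k + 1) ↪ ι, x (e 0) * ∏ r, x (e r)

/-- Splitting off the first index: the remaining index runs through the indices used already or
through new ones. -/
lemma sum_mul_injSum (k : ℕ) (x : ι → ℝ) :
    (∑ i, x i) * injSum (k + 1) x = injSum (k + 2) x + (k + 1) * injSumSq k x := by
  classical
  have h1 : injSum (k + 2) x =
      ∑ e : Fin (k + 1) ↪ ι, ∑ m ∈ (univ.map e)ᶜ, x m * ∏ r, x (e r) := by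
    rw [injSum, sum_embedding_succ (fun e => ∏ r, x (e r))]
    simp [Fin.prod_univ_succ (n := k + 1)]
  have h2 : (k + 1) * injSumSq k x =
      ∑ e : Fin (k + 1) ↪ ι, ∑ r : Fin (k + 1), x (e r) * ∏ r, x (e r) := by
    rw [Finset.sum_comm]
    have : ∀ r : Fin (k + 1), ∑ e : Fin (k + 1) ↪ ι, x (e r) * ∏ r, x (e r) = injSumSq k x := by
      intro r
      rw [injSumSq, ← sum_embedding_comp_perm (Equiv.swap 0 r)
        (fun e => x (e 0) * ∏ r, x (e r))]
      refine Finset.sum_congr rfl fun e _ => ?_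
      beta_reduce
      rw [Equiv.swap_apply_left, Equiv.prod_comp (Equiv.swap 0 r) (fun r => x (e r))]
    simp [this]
  rw [h1, h2, ← Finset.sum_add_distrib, injSum, Finset.mul_sum]
  refine Finset.sum_congr rfl fun e _ => ?_
  rw [← Finset.sum_mul, ← Finset.sum_mul, ← add_mul]
  congr 1
  rw [← Finset.sum_compl_add_sum (univ.map e), Finset.sum_map]

/-- Comparing `x a * x b` with the mean of `x a ^ 2` and `x b ^ 2` in the first two factors. -/
lemma injSum_le_injSumSq {x : ι → ℝ} (hx : ∀ i, 0 ≤ x i) (k : ℕ) :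
    injSum (k + 2) x ≤ ((Fintype.card ι : ℝ) - (k + 1)) * injSumSq k x := by
  classical
  let P (e : Fin (k + 2) → ι) : ℝ := ∏ r : Fin k, x (e r.succ.succ)
  have h0 : injSum (k + 2) x = ∑ e : Fin (k + 2) ↪ ι, x (e 0) * x (e 1) * P e := by
    refine Finset.sum_congr rfl fun e _ => ?_
    rw [Fin.prod_univ_succ, Fin.prod_univ_succ, mul_assoc]; rfl
  have h1 : ∑ e : Fin (k + 2) ↪ ι, x (e 1) ^ 2 * P e =
      ((Fintype.card ι : ℝ) - (k + 1)) * injSumSq k x := by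
    rw [sum_embedding_succ (fun e => x (e 1) ^ 2 * P e), injSumSq, Finset.mul_sum]
    refine Finset.sum_congr rfl fun e _ => ?_
    have hc : ((#(univ.map e)ᶜ : ℕ) : ℝ) = (Fintype.card ι : ℝ) - (k + 1) := by
      rw [Finset.card_compl, Nat.cast_sub (Finset.card_le_univ _)]
      simp
    have : ∀ m : ι, x ((Fin.cons m e : Fin (k + 2) → ι) 1) ^ 2 *
        P (Fin.cons m e : Fin (k + 2) → ι) = x (e 0) * ∏ r, x (e r) := by
      intro m
      rw [Fin.prod_univ_succ, ← mul_assoc, ← sq]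
      rfl
    simp only [this, Finset.sum_const, nsmul_eq_mul, hc]
  have h2 : ∑ e : Fin (k + 2) ↪ ι, x (e 0) ^ 2 * P e =
      ∑ e : Fin (k + 2) ↪ ι, x (e 1) ^ 2 * P e := by
    rw [← sum_embedding_comp_perm (Equiv.swap 0 1) (fun e => x (e 1) ^ 2 * P e)]
    refine Finset.sum_congr rfl fun e _ => ?_
    have : P (fun r => e (Equiv.swap 0 1 r)) = P e := by
      refine Finset.prod_congr rfl fun r _ => ?_
      beta_reduce
      rw [Equiv.swap_apply_of_ne_of_ne (Fin.succ_ne_zero _)]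
      exact fun h => Fin.succ_ne_zero r (Fin.succ_injective _ h)
    beta_reduce
    rw [this, Equiv.swap_apply_right]
  have h3 : 0 ≤ ∑ e : Fin (k + 2) ↪ ι, (x (e 0) - x (e 1)) ^ 2 * P e :=
    Finset.sum_nonneg fun e _ => mul_nonneg (sq_nonneg _) (Finset.prod_nonneg fun _ _ => hx _)
  have h4 : ∑ e : Fin (k + 2) ↪ ι, (x (e 0) - x (e 1)) ^ 2 * P e =
      ∑ e : Fin (k + 2) ↪ ι, x (e 0) ^ 2 * P e + ∑ e : Fin (k + 2) ↪ ι, x (e 1) ^ 2 * P e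
        - 2 * ∑ e : Fin (k + 2) ↪ ι, x (e 0) * x (e 1) * P e := by
    rw [Finset.mul_sum, ← Finset.sum_add_distrib, ← Finset.sum_sub_distrib]
    exact Finset.sum_congr rfl fun e _ => by ring
  rw [h4, h2, h1, ← h0] at h3
  linarith

/-- One step of Maclaurin's inequality. -/
lemma card_mul_injSum_le {x : ι → ℝ} (hx : ∀ i, 0 ≤ x i) (k : ℕ) :
    Fintype.card ι * injSum (k + 2) x ≤
      ((Fintype.card ι : ℝ) - (k + 1)) * ((∑ i, x i) * injSum (k + 1) x) := by
  have h1 := sum_mul_injSum k x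
  have h2 := mul_le_mul_of_nonneg_left (injSum_le_injSumSq hx k)
    (by positivity : (0 : ℝ) ≤ k + 1)
  rw [h1]
  linarith

lemma injSum_two (x : ι → ℝ) : injSum 2 x = (∑ i, x i) ^ 2 - ∑ i, x i ^ 2 := by
  have h := sum_mul_injSum 0 x
  have : injSumSq 0 x = ∑ i, x i ^ 2 := by
    classical
    rw [injSumSq, sum_embedding_succ (fun e => x (e 0) * ∏ r, x (e r))]
    simp [sq]
  simp only [zero_add, injSum_one, this] at h
  norm_num at h
  linarith

/-- Maclaurin's inequality, reduced to the second elementary symmetric polynomial. -/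
lemma injSum_le_injSum_two {x : ι → ℝ} (hx : ∀ i, 0 ≤ x i) {k : ℕ} (hk : k + 2 ≤ Fintype.card ι) :
    Fintype.card ι * ((Fintype.card ι : ℝ) - 1) * injSum (k + 2) x ≤
      (Fintype.card ι).descFactorial (k + 2) * ((∑ i, x i) / Fintype.card ι) ^ k *
        injSum 2 x := by
  induction k with
  | zero =>
    have h : ((Fintype.card ι - 1 : ℕ) : ℝ) = (Fintype.card ι : ℝ) - 1 := by
      rw [Nat.cast_sub (by omega)]; simp
    simp only [Nat.descFactorial, Nat.sub_zero, mul_one, zero_add, pow_zero, Nat.cast_mul, h]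
    exact le_of_eq (by ring)
  | succ k ih =>
    have ih := ih (by omega)
    have hs := card_mul_injSum_le hx (k + 1)
    set n : ℝ := (Fintype.card ι : ℝ) with hn
    set e := ∑ i, x i with he
    have hn0 : 0 < n := by rw [hn]; exact_mod_cast (by omega : 0 < Fintype.card ι)
    have he0 : 0 ≤ e := Finset.sum_nonneg fun i _ => hx i
    have hk' : ((k : ℝ) + 1 + 2) ≤ n := by rw [hn]; exact_mod_cast hk
    have hd : (((Fintype.card ι).descFactorial (k + 1 + 2) : ℕ) : ℝ) =
        (n - (k + 2)) * (Fintype.card ι).descFactorial (k + 2) := by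
      rw [show k + 1 + 2 = (k + 2) + 1 from by ring, Nat.descFactorial_succ, Nat.cast_mul,
        Nat.cast_sub (by omega)]
      push_cast; ring
    rw [hd]
    have hs' : injSum (k + 1 + 2) x ≤ (n - (k + 2)) * (e / n) * injSum (k + 2) x := by
      have : injSum (k + 1 + 2) x ≤ (n - ((k + 1 : ℕ) + 1)) * (e * injSum (k + 2) x) / n := by
        rw [le_div_iff₀ hn0, mul_comm]; exact hs
      refine this.trans (le_of_eq ?_)
      push_cast; field_simp; ring
    have hA : 0 ≤ n * (n - 1) := mul_nonneg hn0.le (by linarith [(k.cast_nonneg : (0:ℝ) ≤ k)])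
    have hB : 0 ≤ (n - (k + 2)) * (e / n) :=
      mul_nonneg (by linarith) (by positivity)
    calc n * (n - 1) * injSum (k + 1 + 2) x
        ≤ n * (n - 1) * ((n - (k + 2)) * (e / n) * injSum (k + 2) x) :=
          mul_le_mul_of_nonneg_left hs' hA
      _ = (n - (k + 2)) * (e / n) * (n * (n - 1) * injSum (k + 2) x) := by ring
      _ ≤ (n - (k + 2)) * (e / n) * _ := mul_le_mul_of_nonneg_left ih hB
      _ = _ := by rw [pow_succ]; ring

lemma sum_sub_mean_sq [Nonempty ι] (x : ι → ℝ) :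
    ∑ i, (x i - (∑ i, x i) / Fintype.card ι) ^ 2 =
      ∑ i, x i ^ 2 - (∑ i, x i) ^ 2 / Fintype.card ι := by
  have hn : (Fintype.card ι : ℝ) ≠ 0 := by simp
  set e := ∑ i, x i with he
  have : ∀ i, (x i - e / Fintype.card ι) ^ 2 =
      x i ^ 2 - 2 * (e / Fintype.card ι) * x i + (e / Fintype.card ι) ^ 2 := fun i => by ring
  simp only [this, Finset.sum_add_distrib, Finset.sum_sub_distrib, ← Finset.mul_sum, ← he,
    Finset.sum_const, Finset.card_univ, nsmul_eq_mul]
  field_simp; ring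

/-- **Maclaurin's inequality** for the sum over injective tuples. -/
lemma injSum_le {x : ι → ℝ} (hx : ∀ i, 0 ≤ x i) {k : ℕ} (hk : k ≤ Fintype.card ι) :
    injSum k x ≤ (Fintype.card ι).descFactorial k * ((∑ i, x i) / Fintype.card ι) ^ k := by
  match k with
  | 0 => simp [injSum_zero]
  | 1 =>
    have : (Fintype.card ι : ℝ) ≠ 0 := by exact_mod_cast (by omega : Fintype.card ι ≠ 0)
    simp only [injSum_one, Nat.descFactorial_one, pow_one]
    exact le_of_eq (by field_simp)
  | k + 2 =>
    have hne : Nonempty ι := Fintype.card_pos_iff.mp (by omega)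
    have h := injSum_le_injSum_two hx hk
    have hm := sum_sub_mean_sq x
    have hm0 : 0 ≤ ∑ i, (x i - (∑ i, x i) / Fintype.card ι) ^ 2 :=
      Finset.sum_nonneg fun _ _ => sq_nonneg _
    have hn : (2 : ℝ) ≤ Fintype.card ι := by exact_mod_cast (by omega : 2 ≤ Fintype.card ι)
    have he0 : 0 ≤ ∑ i, x i := Finset.sum_nonneg fun i _ => hx i
    rw [injSum_two] at h
    generalize (Fintype.card ι : ℝ) = n at *
    generalize ∑ i, x i = e at *
    have h2 : e ^ 2 - ∑ i, x i ^ 2 ≤ n * (n - 1) * (e / n) ^ 2 := by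
      have : n * (n - 1) * (e / n) ^ 2 = e ^ 2 - e ^ 2 / n := by field_simp
      linarith
    have h3 : n * (n - 1) * injSum (k + 2) x ≤ n * (n - 1) *
        ((Fintype.card ι).descFactorial (k + 2) * (e / n) ^ (k + 2)) := by
      refine h.trans ((mul_le_mul_of_nonneg_left h2 (by positivity)).trans (le_of_eq ?_))
      rw [pow_add]; ring
    exact le_of_mul_le_mul_left h3 (by nlinarith)

/-- The equality case of Maclaurin's inequality. -/
lemma eq_mean_of_le_injSum {x : ι → ℝ} (hx : ∀ i, 0 ≤ x i) {k : ℕ} (hk2 : 2 ≤ k)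
    (hk : k ≤ Fintype.card ι) (hpos : 0 < ∑ i, x i)
    (h : (Fintype.card ι).descFactorial k * ((∑ i, x i) / Fintype.card ι) ^ k ≤ injSum k x)
    (i : ι) : x i = (∑ i, x i) / Fintype.card ι := by
  obtain ⟨k, rfl⟩ : ∃ m, k = m + 2 := ⟨k - 2, by omega⟩
  have hne : Nonempty ι := Fintype.card_pos_iff.mp (by omega)
  have h1 := injSum_le_injSum_two hx hk
  have hm := sum_sub_mean_sq x
  have hn : (2 : ℝ) ≤ Fintype.card ι := by exact_mod_cast (by omega : 2 ≤ Fintype.card ι)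
  have hd : (0 : ℝ) < (Fintype.card ι).descFactorial (k + 2) := by
    exact_mod_cast Nat.descFactorial_pos.mpr hk
  suffices h0 : ∑ i, (x i - (∑ i, x i) / Fintype.card ι) ^ 2 ≤ 0 by
    have := (Finset.sum_eq_zero_iff_of_nonneg (fun i _ => sq_nonneg _)).mp
      (le_antisymm h0 (Finset.sum_nonneg fun _ _ => sq_nonneg _)) i (Finset.mem_univ i)
    exact sub_eq_zero.mp (pow_eq_zero_iff two_ne_zero |>.mp this)
  rw [injSum_two] at h1
  rw [hm]
  generalize (Fintype.card ι : ℝ) = n at *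
  generalize ∑ i, x i = e at *
  have hn1 : 0 < n * (n - 1) := by nlinarith
  have h2 := (mul_le_mul_of_nonneg_left h hn1.le).trans h1
  have hq : 0 < (e / n) ^ k := by positivity
  have h3 : n * (n - 1) * (e / n) ^ 2 ≤ e ^ 2 - ∑ i, x i ^ 2 := by
    refine le_of_mul_le_mul_left ?_ (mul_pos hd hq)
    refine le_trans (le_of_eq ?_) h2
    rw [pow_add]; ring
  have : n * (n - 1) * (e / n) ^ 2 = e ^ 2 - e ^ 2 / n := by field_simp
  linarith

end Maclaurin

/-! ### Sums of principal minors -/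

section MinorSum

open Matrix

/-- The sum of the determinants of all `k × k` submatrices `A (j r) (j s)`, over all `k`-tuples
`j` of indices. Tuples with a repetition contribute zero, so this is `k!` times the sum of the
principal minors of order `k`. -/
noncomputable def minorSum {n : Type*} [Fintype n] (k : ℕ) (A : Matrix n n ℝ) : ℝ :=
  ∑ j : Fin k → n, (A.submatrix j j).det

variable {m n : Type*} [Fintype n]

lemma det_submatrix_mul {k : ℕ} (A : Matrix m n ℝ) (B : Matrix n m ℝ) (j : Fin k → m) :
    ((A * B).submatrix j j).det =
      ∑ i : Fin k → n, (∏ r, A (j r) (i r)) * (B.submatrix i j).det := by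
  classical
  have h : (A * B).submatrix j j = fun r => ∑ i : n, A (j r) i • (fun s => B i (j s)) := by
    ext r s
    simp [Matrix.mul_apply, Finset.sum_apply]
  rw [h]
  change detRowAlternating.toMultilinearMap _ = _
  rw [MultilinearMap.map_sum]
  refine Finset.sum_congr rfl fun i _ => ?_
  rw [MultilinearMap.map_smul_univ]
  rfl

/-- Sums of principal minors are invariant under exchanging the factors of a product: both sides
expand to the same double sum, one by rows and the other one by columns. -/
lemma minorSum_mul_comm [Fintype m] (k : ℕ) (A : Matrix m n ℝ) (B : Matrix n m ℝ) :
    minorSum k (A * B) = minorSum k (B * A) := by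
  have h2 : ∀ i : Fin k → n, ((B * A).submatrix i i).det =
      ∑ j : Fin k → m, (∏ r, A (j r) (i r)) * (B.submatrix i j).det := by
    intro i
    rw [← det_transpose, transpose_submatrix, transpose_mul, det_submatrix_mul]
    refine Finset.sum_congr rfl fun j _ => ?_
    rw [← det_transpose (B.submatrix i j)]
    rfl
  simp only [minorSum, det_submatrix_mul A B, h2]
  exact Finset.sum_comm

lemma det_submatrix_eq_zero_of_not_injective {m : Type*} {k : ℕ} (A : Matrix m m ℝ) (j : Fin k → m)
    (hj : ¬ Function.Injective j) : (A.submatrix j j).det = 0 := by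
  simp only [Function.Injective, not_forall] at hj
  obtain ⟨a, b, hab, hne⟩ := hj
  exact det_zero_of_row_eq hne (by ext s; simp [hab])

lemma minorSum_eq_sum_embedding (k : ℕ) (A : Matrix n n ℝ) :
    minorSum k A = ∑ e : Fin k ↪ n, (A.submatrix e e).det :=
  sum_eq_sum_embedding _ (det_submatrix_eq_zero_of_not_injective A)

lemma minorSum_diagonal [DecidableEq n] (k : ℕ) (x : n → ℝ) :
    minorSum k (diagonal x) = injSum k x := by
  rw [minorSum_eq_sum_embedding, injSum]
  refine Finset.sum_congr rfl fun e _ => ?_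
  rw [submatrix_diagonal _ _ e.injective, det_diagonal]
  rfl

variable [DecidableEq n]

lemma minorSum_eq_injSum_eigenvalues {A : Matrix n n ℝ} (hA : A.IsHermitian) (k : ℕ) :
    minorSum k A = injSum k hA.eigenvalues := by
  conv_lhs => rw [hA.spectral_theorem, Unitary.conjStarAlgAut_apply]
  rw [minorSum_mul_comm, ← Matrix.mul_assoc, Unitary.coe_star_mul_self, Matrix.one_mul,
    minorSum_diagonal]
  rfl

lemma sum_eigenvalues {A : Matrix n n ℝ} (hA : A.IsHermitian) :
    ∑ i, hA.eigenvalues i = A.trace := by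
  simpa using hA.trace_eq_sum_eigenvalues.symm

/-- The upper bound for sums of principal minors of a positive semidefinite matrix in terms of the
trace, by Maclaurin's inequality for its eigenvalues. -/
lemma minorSum_le {A : Matrix n n ℝ} (hA : A.PosSemidef) {k : ℕ} (hk : k ≤ Fintype.card n) :
    minorSum k A ≤ (Fintype.card n).descFactorial k * (A.trace / Fintype.card n) ^ k := by
  rw [minorSum_eq_injSum_eigenvalues hA.1, ← sum_eigenvalues hA.1]
  exact injSum_le hA.eigenvalues_nonneg hk

lemma eq_smul_one_of_le_minorSum {A : Matrix n n ℝ} (hA : A.PosSemidef) {k : ℕ} (hk2 : 2 ≤ k)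
    (hk : k ≤ Fintype.card n) (hpos : 0 < A.trace)
    (h : (Fintype.card n).descFactorial k * (A.trace / Fintype.card n) ^ k ≤ minorSum k A) :
    A = (A.trace / Fintype.card n) • (1 : Matrix n n ℝ) := by
  rw [minorSum_eq_injSum_eigenvalues hA.1] at h
  have ht := sum_eigenvalues hA.1
  have he := eq_mean_of_le_injSum hA.eigenvalues_nonneg hk2 hk (by rwa [ht]) (by rwa [ht])
  have hd : (diagonal (RCLike.ofReal ∘ hA.1.eigenvalues) : Matrix n n ℝ) =
      (A.trace / Fintype.card n) • (1 : Matrix n n ℝ) := by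
    rw [smul_one_eq_diagonal]
    congr 1
    ext i
    simp [he i, ht]
  conv_lhs => rw [hA.1.spectral_theorem, Unitary.conjStarAlgAut_apply, hd]
  simp

lemma minorSum_smul_one (k : ℕ) (c : ℝ) :
    minorSum k (c • (1 : Matrix n n ℝ)) = (Fintype.card n).descFactorial k * c ^ k := by
  rw [smul_one_eq_diagonal, minorSum_diagonal, injSum_const]

end MinorSum

/-! ### Determinants of differences -/

section DiffDet

open Matrix

/-- The matrix of the differences to the point with index `0`: if `B` is the Gram matrix of
`x 0, …, x m`, this is the Gram matrix of `x 1 - x 0, …, x m - x 0`. -/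
def diffMatrix {m : ℕ} (B : Matrix (Fin (m + 1)) (Fin (m + 1)) ℝ) : Matrix (Fin m) (Fin m) ℝ :=
  of fun r s => B r.succ s.succ - B 0 s.succ - (B r.succ 0 - B 0 0)

/-- A form of the matrix determinant lemma for a perturbation `1 * 1ᵀ`, without any invertibility
assumption. -/
lemma det_add_ones {m : ℕ} (B : Matrix (Fin m) (Fin m) ℝ) :
    (of fun r s => B r s + 1).det = B.det + ∑ r, (B.updateRow r 1).det := by
  suffices h : ∀ t : Finset (Fin m), (of fun r s => B r s + if r ∈ t then 1 else 0).det =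
      B.det + ∑ r ∈ t, (B.updateRow r 1).det by
    simpa using h univ
  intro t
  induction t using Finset.induction_on with
  | empty => simp; rfl
  | insert a t ha ih =>
    rw [Finset.sum_insert ha, add_left_comm, ← ih]
    set X : Matrix (Fin m) (Fin m) ℝ := of fun r s => B r s + if r ∈ t then 1 else 0 with hX
    have h1 : (of fun r s => B r s + if r ∈ insert a t then 1 else 0 : Matrix _ _ ℝ) =
        X.updateRow a (1 + X a) := by
      ext r s
      by_cases hr : r = a
      · subst hr; simp [hX, ha, add_comm]
      · simp [hX, hr]
    rw [h1, det_updateRow_add, updateRow_eq_self]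
    congr 1
    refine det_eq_of_forall_row_eq_smul_add_const (fun r => if r ∈ t then 1 else 0) a (by simp [ha])
      fun r s => ?_
    by_cases hr : r = a
    · subst hr; simp [ha]
    · simp [hX, hr]

lemma det_diffMatrix {m : ℕ} (B : Matrix (Fin (m + 1)) (Fin (m + 1)) ℝ) :
    (diffMatrix B).det = ∑ r, (B.updateRow r 1).det := by
  let b : Fin (m + 1) → Fin (m + 1) → ℝ := Fin.cons (B 0) fun r s => B r.succ s - B 0 s
  let b1 : Matrix (Fin (m + 1)) (Fin (m + 1)) ℝ := updateRow (of b) 0 1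
  have hB : B.det = (of b).det := by
    refine det_eq_of_forall_row_eq_smul_add_const (Fin.cons 0 fun _ => 1) 0 rfl fun r s => ?_
    refine Fin.cases ?_ (fun r => ?_) r <;> simp [b]
  have h1 : (of fun r s => B r s + 1).det = (of b).det + b1.det := by
    have : (of b).det + b1.det = (updateRow (of b) 0 (B 0 + 1)).det := by
      rw [det_updateRow_add]
      congr 2
      rw [eq_comm]
      exact updateRow_eq_self (of b) 0
    rw [this]
    refine det_eq_of_forall_row_eq_smul_add_const (Fin.cons 0 fun _ => 1) 0 rfl fun r s => ?_
    refine Fin.cases ?_ (fun r => ?_) r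
    · simp
    · simp [b, Fin.succ_ne_zero]; ring
  have h2 : b1.det = (diffMatrix B).det := by
    let c : Matrix (Fin (m + 1)) (Fin (m + 1)) ℝ :=
      of fun r s => Fin.cases (b1 r 0) (fun s => b1 r s.succ - b1 r 0) s
    have hc : b1.det = c.det := by
      rw [← det_transpose, ← det_transpose c]
      refine det_eq_of_forall_row_eq_smul_add_const (Fin.cons 0 fun _ => 1) 0 rfl fun s r => ?_
      refine Fin.cases ?_ (fun s => ?_) s <;> simp [c]
    rw [hc, det_succ_row_zero, Fin.sum_univ_succ]
    have h0 : c 0 0 = 1 := by simp [c, b1]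
    have hs : ∀ s : Fin m, c 0 s.succ = 0 := by intro s; simp [c, b1]
    have hd : c.submatrix Fin.succ Fin.succ = diffMatrix B := by
      ext r s
      simp [c, b1, b, diffMatrix, Fin.succ_ne_zero]
    simp [h0, hs, hd]
  have h3 := det_add_ones B
  rw [h1, hB] at h3
  rw [← h2]
  linarith

variable {n : Type*} [Fintype n]

lemma sum_det_updateRow_submatrix {m : ℕ} (A : Matrix n n ℝ) (r : Fin (m + 1)) :
    ∑ j : Fin (m + 1) → n, ((A.submatrix j j).updateRow r 1).det =
      ∑ j : Fin (m + 1) → n, ((A.submatrix j j).updateRow 0 1).det := by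
  let σ := Equiv.swap 0 r
  refine Fintype.sum_equiv (Equiv.arrowCongr σ (Equiv.refl n)) _ _ fun j => ?_
  rw [← det_submatrix_equiv_self σ]
  congr 1
  ext a b
  simp only [submatrix_apply, updateRow_apply, Equiv.arrowCongr_apply, Equiv.coe_refl,
    Function.comp_apply, id_eq]
  have : σ.symm = σ := Equiv.symm_swap 0 r
  have h2 : σ a = r ↔ a = 0 := by
    rw [← σ.injective.eq_iff (a := a)]
    simp [σ]
  simp [this, h2]

/-- If the rows of `A` sum up to zero, then the sum of the determinants of the difference
matrices is a sum of principal minors of `A`: all mixed terms cancel. -/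
lemma sum_det_diffMatrix {m : ℕ} (A : Matrix n n ℝ) (hA : ∀ r, ∑ s, A r s = 0) :
    ∑ j : Fin (m + 1) → n, (diffMatrix (A.submatrix j j)).det =
      (m + 1) * (Fintype.card n * minorSum m A) := by
  simp only [det_diffMatrix]
  rw [Finset.sum_comm]
  simp only [sum_det_updateRow_submatrix A]
  rw [Finset.sum_const, Finset.card_univ, Fintype.card_fin, nsmul_eq_mul]
  push_cast
  congr 1
  rw [← Equiv.sum_comp (Fin.consEquiv (fun _ => n)), Fintype.sum_prod_type_right, minorSum,
    Finset.mul_sum]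
  refine Finset.sum_congr rfl fun j _ => ?_
  -- Only the column with index `0` depends on the summation index.
  have h1 : ∀ a : n, ((A.submatrix (Fin.consEquiv (fun _ => n) (a, j))
      (Fin.consEquiv (fun _ => n) (a, j))).updateRow 0 1).det =
      ∑ r : Fin (m + 1), (-1) ^ (r : ℕ) * (Fin.cons 1 (fun r => A (j r) a) : Fin (m + 1) → ℝ) r *
        ((of (Fin.cons (fun _ => 1) fun r s => A (j r) (j s)) :
          Matrix (Fin (m + 1)) (Fin m) ℝ).submatrix r.succAbove id).det := by
    intro a
    rw [det_succ_column_zero]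
    refine Finset.sum_congr rfl fun r _ => ?_
    congr 2
    · refine Fin.cases ?_ (fun r => ?_) r <;> simp [Fin.succ_ne_zero]
    · ext s t
      simp only [submatrix_apply]
      refine Fin.cases ?_ (fun q => ?_) (r.succAbove s) <;> simp [Fin.succ_ne_zero]
  simp only [h1]
  rw [Finset.sum_comm, Fin.sum_univ_succ, add_eq_left.mpr]
  · simp only [Fin.val_zero, pow_zero, Fin.cons_zero, one_mul, Finset.sum_const, Finset.card_univ,
      nsmul_eq_mul]
    congr 2
  · refine Finset.sum_eq_zero fun r _ => ?_
    rw [← Finset.sum_mul, ← Finset.mul_sum]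
    simp [hA]

end DiffDet

/-! ### Volumes as Gram determinants -/

section Volume

open MeasureTheory Matrix

variable {E : Type*} [NormedAddCommGroup E] [InnerProductSpace ℝ E]

/-- The linear map that sends the standard basis to the vectors `v r`. -/
noncomputable def ofVectors {m : ℕ} (v : Fin m → E) : EuclideanSpace ℝ (Fin m) →ₗ[ℝ] E :=
  (EuclideanSpace.basisFun (Fin m) ℝ).toBasis.constr ℝ v

lemma ofVectors_basisFun {m : ℕ} (v : Fin m → E) (r : Fin m) :
    ofVectors v (EuclideanSpace.basisFun (Fin m) ℝ r) = v r := by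
  rw [ofVectors, ← OrthonormalBasis.coe_toBasis, Module.Basis.constr_basis]

lemma toReal_euclideanHausdorffMeasure_image [MeasurableSpace E] [BorelSpace E] {m : ℕ}
    (v : Fin m → E) (T : Set (EuclideanSpace ℝ (Fin m))) :
    (Measure.euclideanHausdorffMeasure m (ofVectors v '' T)).toReal =
      √(gram ℝ v).det * (volume T).toReal := by
  have h := (ofVectors v).euclideanHausdorffMeasure_image_eq_normDet_mul_volume T
  rw [finrank_euclideanSpace_fin] at h
  have h2 := (ofVectors v).normDet_sq_eq_det_gram (EuclideanSpace.basisFun (Fin m) ℝ)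
  simp only [ofVectors_basisFun] at h2
  rw [h, ENNReal.toReal_mul, ENNReal.toReal_ofReal (LinearMap.normDet_nonneg _), ← h2]
  simp [Real.sqrt_sq (LinearMap.normDet_nonneg _)]

lemma volV_eq {d k : ℕ} (x : Fin k → Sph d) :
    volV x = √(gram ℝ fun i => (x i : EuclideanSpace ℝ (Fin d))).det := by
  have h := toReal_euclideanHausdorffMeasure_image
    (fun i => (x i : EuclideanSpace ℝ (Fin d))) (parallelepiped (EuclideanSpace.basisFun (Fin k) ℝ))
  rw [OrthonormalBasis.volume_parallelepiped, image_parallelepiped] at h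
  simp only [Function.comp_def, ofVectors_basisFun, ENNReal.toReal_one, mul_one] at h
  exact h

/-- The simplex spanned by the origin and the standard basis vectors. -/
def cornerSimplex (m : ℕ) : Set (EuclideanSpace ℝ (Fin m)) :=
  convexHull ℝ (insert 0 (Set.range (EuclideanSpace.basisFun (Fin m) ℝ)))

lemma volume_cornerSimplex_pos (m : ℕ) : 0 < (volume (cornerSimplex m)).toReal := by
  refine ENNReal.toReal_pos ?_ ?_
  · refine (Measure.measure_pos_of_nonempty_interior _ ?_).ne'
    rw [cornerSimplex, interior_convexHull_nonempty_iff_affineSpan_eq_top,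
      ← AffineSubspace.coe_eq_univ_iff, affineSpan_insert_zero,
      ← OrthonormalBasis.coe_toBasis, Module.Basis.span_eq]
    simp
  · refine (Bornology.IsBounded.measure_lt_top ?_).ne
    rw [cornerSimplex, isBounded_convexHull]
    exact ((Set.finite_range _).insert 0).isBounded

lemma diffMatrix_gram {m : ℕ} (x : Fin (m + 1) → E) :
    diffMatrix (gram ℝ x) = gram ℝ fun r : Fin m => x r.succ - x 0 := by
  ext r s
  simp only [diffMatrix, of_apply, gram_apply, inner_sub_left, inner_sub_right]

lemma volA_eq {d m : ℕ} (x : Fin (m + 1) → Sph d) :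
    volA x = (volume (cornerSimplex m)).toReal *
      √(diffMatrix (gram ℝ fun i => (x i : EuclideanSpace ℝ (Fin d)))).det := by
  let v : Fin m → EuclideanSpace ℝ (Fin d) := fun r => x r.succ - x 0
  have hg : diffMatrix (gram ℝ fun i => (x i : EuclideanSpace ℝ (Fin d))) = gram ℝ v :=
    diffMatrix_gram _
  have hi : convexHull ℝ (Set.range fun i => (x i : EuclideanSpace ℝ (Fin d))) =
      (fun y => (x 0 : EuclideanSpace ℝ (Fin d)) + y) '' (ofVectors v '' cornerSimplex m) := by
    have h1 : Set.range (fun i => (x i : EuclideanSpace ℝ (Fin d))) =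
        (fun y => (x 0 : EuclideanSpace ℝ (Fin d)) + y) ''
          (ofVectors v '' insert 0 (Set.range (EuclideanSpace.basisFun (Fin m) ℝ))) := by
      rw [Set.image_insert_eq, Set.image_insert_eq, ← Set.range_comp, ← Set.range_comp]
      simp only [Function.comp_def, ofVectors_basisFun, map_zero, add_zero, v, add_sub_cancel]
      exact Fin.range_cons (x 0 : EuclideanSpace ℝ (Fin d)) (fun r => (x r.succ : _)) ▸ by
        congr 1
        ext i
        refine Fin.cases ?_ (fun i => ?_) i <;> rfl
    have h2 := ((AffineEquiv.constVAdd ℝ (EuclideanSpace ℝ (Fin d))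
      (x 0 : EuclideanSpace ℝ (Fin d))).toAffineMap.comp
      (ofVectors v).toAffineMap).image_convexHull
      (insert 0 (Set.range (EuclideanSpace.basisFun (Fin m) ℝ)))
    rw [h1, ← Set.image_comp, ← Set.image_comp, cornerSimplex]
    exact h2.symm
  have ht : Isometry fun y => (x 0 : EuclideanSpace ℝ (Fin d)) + y :=
    (IsometryEquiv.addLeft (x 0 : EuclideanSpace ℝ (Fin d))).isometry
  rw [volA, hi, ht.euclideanHausdorffMeasure_image, hg, mul_comm]
  exact toReal_euclideanHausdorffMeasure_image v (cornerSimplex m)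

end Volume

/-! ### Tight frames -/

section Frames

open Matrix

variable {n : Type*} {d : ℕ}

/-- The matrix whose rows are the coordinates of the vectors `y i`. -/
def coordMatrix (y : n → EuclideanSpace ℝ (Fin d)) : Matrix n (Fin d) ℝ := of fun i a => y i a

lemma gram_eq_mul_transpose (y : n → EuclideanSpace ℝ (Fin d)) :
    gram ℝ y = coordMatrix y * (coordMatrix y)ᵀ := by
  ext i j
  simp only [gram_apply, PiLp.inner_apply, mul_apply, coordMatrix, transpose_apply, of_apply]
  exact Finset.sum_congr rfl fun a _ => by simp [mul_comm]

variable [Fintype n]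

/-- The matrix of the frame operator `∑ i, y i (y i)ᵀ`. -/
def frameMatrix (y : n → EuclideanSpace ℝ (Fin d)) : Matrix (Fin d) (Fin d) ℝ :=
  (coordMatrix y)ᵀ * coordMatrix y

lemma posSemidef_frameMatrix (y : n → EuclideanSpace ℝ (Fin d)) : (frameMatrix y).PosSemidef := by
  have := posSemidef_conjTranspose_mul_self (coordMatrix y)
  rwa [conjTranspose_eq_transpose_of_trivial] at this

lemma minorSum_gram (k : ℕ) (y : n → EuclideanSpace ℝ (Fin d)) :
    minorSum k (gram ℝ y) = minorSum k (frameMatrix y) := by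
  rw [gram_eq_mul_transpose, minorSum_mul_comm, frameMatrix]

lemma trace_frameMatrix (y : n → EuclideanSpace ℝ (Fin d)) :
    (frameMatrix y).trace = ∑ i, ‖y i‖ ^ 2 := by
  rw [frameMatrix, trace_mul_comm, ← gram_eq_mul_transpose, trace]
  simp

lemma minorSum_gram_le (y : n → EuclideanSpace ℝ (Fin d)) {k : ℕ} (hk : k ≤ d) :
    minorSum k (gram ℝ y) ≤ d.descFactorial k * ((∑ i, ‖y i‖ ^ 2) / d) ^ k := by
  have := minorSum_le (posSemidef_frameMatrix y) (k := k) (by simpa using hk)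
  simpa [minorSum_gram, trace_frameMatrix] using this

lemma frameMatrix_eq_of_le_minorSum (y : n → EuclideanSpace ℝ (Fin d)) {k : ℕ} (hk2 : 2 ≤ k)
    (hk : k ≤ d) (hpos : 0 < ∑ i, ‖y i‖ ^ 2)
    (h : d.descFactorial k * ((∑ i, ‖y i‖ ^ 2) / d) ^ k ≤ minorSum k (gram ℝ y)) :
    frameMatrix y = ((∑ i, ‖y i‖ ^ 2) / d) • (1 : Matrix (Fin d) (Fin d) ℝ) := by
  have := eq_smul_one_of_le_minorSum (posSemidef_frameMatrix y) hk2 (by simpa using hk)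
    (by rwa [trace_frameMatrix]) (by simpa [minorSum_gram, trace_frameMatrix] using h)
  simpa [trace_frameMatrix] using this

lemma minorSum_gram_of_frameMatrix_eq {y : n → EuclideanSpace ℝ (Fin d)} {c : ℝ}
    (h : frameMatrix y = c • (1 : Matrix (Fin d) (Fin d) ℝ)) (k : ℕ) :
    minorSum k (gram ℝ y) = d.descFactorial k * c ^ k := by
  rw [minorSum_gram, h, minorSum_smul_one, Fintype.card_fin]

lemma gram_mul_gram_of_frameMatrix_eq {y : n → EuclideanSpace ℝ (Fin d)} {c : ℝ}
    (h : frameMatrix y = c • (1 : Matrix (Fin d) (Fin d) ℝ)) :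
    gram ℝ y * gram ℝ y = c • gram ℝ y := by
  rw [gram_eq_mul_transpose]
  calc _ = coordMatrix y * frameMatrix y * (coordMatrix y)ᵀ := by
        simp only [frameMatrix, Matrix.mul_assoc]
    _ = _ := by rw [h]; simp

lemma sum_inner_smul_of_frameMatrix_eq {y : n → EuclideanSpace ℝ (Fin d)} {c : ℝ}
    (h : frameMatrix y = c • (1 : Matrix (Fin d) (Fin d) ℝ)) (x : EuclideanSpace ℝ (Fin d)) :
    ∑ i, inner ℝ (y i) x • y i = c • x := by
  ext a
  have h1 := congrFun (congrArg (fun M => M *ᵥ (x : Fin d → ℝ)) h) a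
  simp only [frameMatrix, ← mulVec_mulVec, smul_mulVec, one_mulVec] at h1
  simp only [PiLp.smul_apply]
  rw [Pi.smul_apply] at h1
  rw [← h1]
  simp only [mulVec, dotProduct, coordMatrix, transpose_apply, of_apply, PiLp.inner_apply]
  simp [mul_comm]

end Frames

/-! ### Regular simplices -/

section Simplex

open Matrix

variable {d : ℕ}

lemma inner_self_sph (x : Sph d) : inner ℝ (x : EuclideanSpace ℝ (Fin d)) x = 1 := by
  rw [real_inner_self_eq_norm_sq, norm_eq_of_mem_sphere]; norm_num

lemma sum_norm_sq_sph {N : ℕ} (z : Fin N → Sph d) :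
    ∑ i, ‖(z i : EuclideanSpace ℝ (Fin d))‖ ^ 2 = N := by
  simp

/-- The points have the inner products of the vertices of a regular simplex. -/
def HasSimplexGram (z : Fin (d + 1) → Sph d) : Prop :=
  ∀ i j, i ≠ j → inner ℝ (z i : EuclideanSpace ℝ (Fin d)) (z j) = -1 / d

lemma exists_sum_smul_eq_zero (z : Fin (d + 1) → Sph d) :
    ∃ c : Fin (d + 1) → ℝ, ∑ i, c i • (z i : EuclideanSpace ℝ (Fin d)) = 0 ∧ ∃ i, c i ≠ 0 := by
  refine Fintype.not_linearIndependent_iff.mp fun h => ?_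
  have := h.fintype_card_le_finrank
  simp at this

/-- If all inner products of `d + 1` distinct unit vectors in dimension `d` are equal, then a linear
dependency between the vectors determines their value. -/
lemma hasSimplexGram_of_const {z : Fin (d + 1) → Sph d} {a : ℝ} (ha : a ≠ 1) (hd : 1 ≤ d)
    (h : ∀ i j, i ≠ j → inner ℝ (z i : EuclideanSpace ℝ (Fin d)) (z j) = a) :
    HasSimplexGram z := by
  obtain ⟨c, hc, i, hi⟩ := exists_sum_smul_eq_zero z
  have h1 : ∀ j, c j * (1 - a) + a * ∑ i, c i = 0 := by
    intro j
    have := congrArg (fun v => inner ℝ v (z j : EuclideanSpace ℝ (Fin d))) hc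
    simp only [sum_inner, inner_smul_left, inner_zero_left] at this
    rw [← this, Finset.mul_sum, ← Finset.add_sum_erase _ _ (Finset.mem_univ j),
      ← Finset.add_sum_erase _ (fun i => _ * inner ℝ _ _) (Finset.mem_univ j), inner_self_sph,
      ← add_assoc]
    congr 1
    · simp; ring
    · refine Finset.sum_congr rfl fun i hi => ?_
      rw [h i j (Finset.ne_of_mem_erase hi)]
      simp [mul_comm]
  have h2 : ∀ j, c j = c i := by
    intro j
    have := (h1 j).trans (h1 i).symm
    exact mul_right_cancel₀ (sub_ne_zero.mpr ha.symm) (by linarith)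
  have h3 := h1 i
  simp only [h2, Finset.sum_const, Finset.card_univ, Fintype.card_fin, nsmul_eq_mul] at h3
  have h4 : c i * (1 + a * d) = 0 := by push_cast at h3; linarith
  have h5 : 1 + a * d = 0 := (mul_eq_zero.mp h4).resolve_left hi
  intro i j hij
  rw [h i j hij, eq_div_iff (by positivity)]
  linarith

lemma HasSimplexGram.isRegularSimplex (hd : 1 ≤ d) {z : Fin (d + 1) → Sph d}
    (h : HasSimplexGram z) : IsRegularSimplex z := by
  have hd0 : (0 : ℝ) < d := by exact_mod_cast hd
  have hi : AffineIndependent ℝ (fun i => (z i : EuclideanSpace ℝ (Fin d))) := by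
    rw [affineIndependent_iff_of_fintype]
    intro c hc h0
    rw [Finset.weightedVSub_eq_linear_combination _ hc] at h0
    intro j
    have h1 := congrArg (fun v => inner ℝ v (z j : EuclideanSpace ℝ (Fin d))) h0
    simp only [sum_inner, inner_smul_left, inner_zero_left] at h1
    rw [← Finset.add_sum_erase _ _ (Finset.mem_univ j), inner_self_sph] at h1
    have h2 : ∑ i ∈ univ.erase j, (starRingEnd ℝ) (c i) *
        inner ℝ (z i : EuclideanSpace ℝ (Fin d)) (z j) = (∑ i ∈ univ.erase j, c i) * (-1 / d) := by
      rw [Finset.sum_mul]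
      exact Finset.sum_congr rfl fun i hi => by rw [h i j (Finset.ne_of_mem_erase hi)]; simp
    rw [h2] at h1
    rw [← Finset.add_sum_erase _ _ (Finset.mem_univ j)] at hc
    rw [eq_neg_of_add_eq_zero_right hc] at h1
    have h3 : c j * (1 + 1 / d) = 0 := by
      simp at h1
      rw [← h1]; ring
    exact (mul_eq_zero.mp h3).resolve_right (by positivity)
  refine ⟨⟨_, hi⟩, ⟨√(2 + 2 / d), fun i j hij => ?_⟩, fun i => rfl⟩
  rw [dist_eq_norm, eq_comm, Real.sqrt_eq_iff_eq_sq (by positivity) (norm_nonneg _),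
    ← real_inner_self_eq_norm_sq, inner_sub_left, inner_sub_right, inner_sub_right,
    inner_self_sph, inner_self_sph, h i j hij, h j i hij.symm]
  ring

lemma isRegularSimplex_iff (hd : 1 ≤ d) {z : Fin (d + 1) → Sph d} :
    IsRegularSimplex z ↔ HasSimplexGram z := by
  refine ⟨fun ⟨S, ⟨r, hr⟩, hS⟩ => ?_, fun h => h.isRegularSimplex hd⟩
  have h1 : ∀ i j, i ≠ j →
      inner ℝ (z i : EuclideanSpace ℝ (Fin d)) (z j) = 1 - r ^ 2 / 2 := by
    intro i j hij
    have := hr i j hij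
    rw [hS, hS, dist_eq_norm] at this
    have h2 := norm_sub_sq_real (z i : EuclideanSpace ℝ (Fin d)) (z j)
    rw [this] at h2
    simp at h2
    linarith
  refine hasSimplexGram_of_const ?_ hd h1
  have h0 : r ≠ 0 := by
    obtain ⟨e, rfl⟩ : ∃ e, d = e + 1 := ⟨d - 1, by omega⟩
    have h01 : (0 : Fin (e + 1 + 1)) ≠ 1 := by simp
    rw [← hr 0 1 h01]
    exact dist_ne_zero.mpr (S.independent.injective.ne h01)
  have : 0 < r ^ 2 := by positivity
  linarith

lemma gram_apply_of_hasSimplexGram {z : Fin (d + 1) → Sph d} (h : HasSimplexGram z)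
    (i j : Fin (d + 1)) : gram ℝ (fun i => (z i : EuclideanSpace ℝ (Fin d))) i j =
      if i = j then 1 else -1 / (d : ℝ) := by
  split_ifs with hij
  · subst hij; exact inner_self_sph _
  · exact h i j hij

/-- The vertices of a regular simplex form a tight frame: the squared Frobenius norm of the
difference between the frame operator and its mean vanishes. -/
lemma HasSimplexGram.frameMatrix_eq (hd : 1 ≤ d) {z : Fin (d + 1) → Sph d}
    (h : HasSimplexGram z) : frameMatrix (fun i => (z i : EuclideanSpace ℝ (Fin d))) =
      (((d + 1 : ℕ) : ℝ) / d) • (1 : Matrix (Fin d) (Fin d) ℝ) := by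
  have hd0 : (d : ℝ) ≠ 0 := by positivity
  set y : Fin (d + 1) → EuclideanSpace ℝ (Fin d) := fun i => z i with hy
  set c : ℝ := ((d + 1 : ℕ) : ℝ) / d with hc
  have hS := (posSemidef_frameMatrix y).1
  have h1 : (frameMatrix y).trace = (d + 1 : ℕ) := by
    rw [trace_frameMatrix, hy, sum_norm_sq_sph]
  have h2 : (frameMatrix y * frameMatrix y).trace = (d + 1 : ℕ) * c := by
    have : (frameMatrix y * frameMatrix y).trace = (gram ℝ y * gram ℝ y).trace := by
      rw [gram_eq_mul_transpose, frameMatrix, Matrix.mul_assoc, trace_mul_comm]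
      simp only [Matrix.mul_assoc]
    rw [this, trace]
    have h3 : ∀ i, (gram ℝ y * gram ℝ y).diag i = c := by
      intro i
      rw [diag_apply, mul_apply, ← Finset.add_sum_erase _ _ (Finset.mem_univ i)]
      have : ∀ j ∈ univ.erase i, gram ℝ y i j * gram ℝ y j i = 1 / (d : ℝ) ^ 2 := by
        intro j hj
        have hji := Finset.ne_of_mem_erase hj
        rw [gram_apply_of_hasSimplexGram h, gram_apply_of_hasSimplexGram h, if_neg hji,
          if_neg hji.symm]
        ring
      rw [Finset.sum_congr rfl this, gram_apply_of_hasSimplexGram h, if_pos rfl]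
      simp [hc]
      field_simp
    rw [Finset.sum_congr rfl fun i _ => h3 i]
    simp
  have h4 : ((frameMatrix y - c • 1)ᴴ * (frameMatrix y - c • 1)).trace = 0 := by
    rw [conjTranspose_sub, hS.eq, conjTranspose_smul, conjTranspose_one, star_trivial]
    simp only [Matrix.sub_mul, Matrix.mul_sub, Matrix.smul_mul, Matrix.mul_smul,
      Matrix.one_mul, Matrix.mul_one, trace_sub,
      trace_smul, h1, h2, trace_one, Fintype.card_fin, smul_eq_mul]
    rw [hc]
    field_simp
    ring
  exact sub_eq_zero.mp (trace_conjTranspose_mul_self_eq_zero_iff.mp h4)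

/-- The standard basis of `ℝ^(d+1)`, projected to the orthogonal complement of the sum `u` of the
basis vectors and rescaled to unit length. -/
lemma exists_hasSimplexGram (hd : 1 ≤ d) : ∃ z : Fin (d + 1) → Sph d, HasSimplexGram z := by
  have hd0 : (0 : ℝ) < d := by positivity
  let b := EuclideanSpace.basisFun (Fin (d + 1)) ℝ
  let u : EuclideanSpace ℝ (Fin (d + 1)) := ∑ i, b i
  have hbb : ∀ i j, inner ℝ (b i) (b j) = if i = j then (1 : ℝ) else 0 :=
    fun i j => orthonormal_iff_ite.mp b.orthonormal i j
  have hub : ∀ i, inner ℝ u (b i) = 1 := fun i => by simp [u, sum_inner, hbb]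
  have huu : inner ℝ u u = (d + 1 : ℝ) := by
    change inner ℝ u (∑ i, b i) = _
    simp [inner_sum, hub]
  have hu : u ≠ 0 := by
    intro h
    rw [h, inner_zero_left] at huu
    linarith
  let W := (Submodule.span ℝ {u})ᗮ
  have hW : Module.finrank ℝ W = d := by
    have : Fact (Module.finrank ℝ (EuclideanSpace ℝ (Fin (d + 1))) = d + 1) := ⟨by simp⟩
    exact Submodule.finrank_orthogonal_span_singleton hu
  let φ : W ≃ₗᵢ[ℝ] EuclideanSpace ℝ (Fin d) :=
    ((stdOrthonormalBasis ℝ W).reindex (finCongr hW)).repr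
  have hmem : ∀ i, b i - (1 / (d + 1 : ℝ)) • u ∈ W := by
    intro i
    rw [Submodule.mem_orthogonal_singleton_iff_inner_right, inner_sub_right, inner_smul_right,
      hub, huu]
    field_simp
    ring
  have hin : ∀ i j, inner ℝ (b i - (1 / (d + 1 : ℝ)) • u) (b j - (1 / (d + 1 : ℝ)) • u) =
      (if i = j then 1 else 0) - 1 / (d + 1 : ℝ) := by
    intro i j
    rw [inner_sub_left, inner_sub_right, inner_sub_right, inner_smul_left, inner_smul_right,
      inner_smul_left, inner_smul_right, hub, huu, real_inner_comm u (b i), hub, hbb]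
    simp only [eq_comm, map_div₀, map_one, map_add, map_natCast]
    field_simp
    ring
  let p : Fin (d + 1) → EuclideanSpace ℝ (Fin d) :=
    fun i => √((d + 1) / d) • φ ⟨b i - (1 / (d + 1 : ℝ)) • u, hmem i⟩
  have hp : ∀ i j, inner ℝ (p i) (p j) = ((d + 1) / d) * ((if i = j then 1 else 0) -
      1 / (d + 1 : ℝ)) := by
    intro i j
    simp only [p, inner_smul_left, inner_smul_right, LinearIsometryEquiv.inner_map_map,
      Submodule.coe_inner, hin, conj_trivial]
    rw [← mul_assoc, Real.mul_self_sqrt (by positivity)]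
  have hn : ∀ i, p i ∈ Metric.sphere (0 : EuclideanSpace ℝ (Fin d)) 1 := by
    intro i
    have h1 := hp i i
    rw [real_inner_self_eq_norm_sq, if_pos rfl] at h1
    have h2 : ‖p i‖ ^ 2 = 1 := by rw [h1]; field_simp; ring
    rw [mem_sphere_zero_iff_norm]
    exact (pow_eq_one_iff_of_nonneg (norm_nonneg _) two_ne_zero).mp h2
  refine ⟨fun i => ⟨p i, hn i⟩, fun i j hij => ?_⟩
  change inner ℝ (p i) (p j) = _
  rw [hp, if_neg hij]
  field_simp
  ring

end Simplex

/-! ### Rigidity of tight frames of `d + 1` unit vectors in dimension `d` -/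

section Rigidity

open Matrix

/-- A symmetric idempotent matrix of order `n` all of whose diagonal entries are `1 / n` is of the
form `ε i * ε j / n` with signs `ε`: the rows have squared norm `1 / n`, so the Cauchy–Schwarz
inequality holds with equality for each pair of rows. -/
lemma exists_signs_of_idempotent {n : Type*} [Fintype n] {K : Matrix n n ℝ}
    (hs : K.IsSymm) (hK : K * K = K) (hd : ∀ i, K i i = 1 / Fintype.card n) :
    ∃ ε : n → ℝ, (∀ i, ε i = 1 ∨ ε i = -1) ∧ ∀ i j, K i j = ε i * ε j / Fintype.card n := by
  classical
  rcases isEmpty_or_nonempty n with hn | ⟨⟨o⟩⟩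
  · exact ⟨fun _ => 1, by simp, fun i => hn.elim i⟩
  have hN0 : 0 < Fintype.card n := Fintype.card_pos_iff.mpr ⟨o⟩
  set N : ℝ := (Fintype.card n : ℝ) with hN
  have hN' : 0 < N := by rw [hN]; exact_mod_cast hN0
  have hsum : ∀ i j, ∑ l, K i l * K j l = K i j := by
    intro i j
    conv_rhs => rw [← hK, mul_apply]
    exact Finset.sum_congr rfl fun l _ => by rw [hs.apply l j]
  have hexp : ∀ (c : ℝ) i j, c ^ 2 = 1 → ∑ l, (K i l - c * K j l) ^ 2 = 2 / N - 2 * c * K i j := by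
    intro c i j hc
    have : ∀ l, (K i l - c * K j l) ^ 2 =
        K i l * K i l + K j l * K j l - 2 * c * (K i l * K j l) := by
      intro l
      linear_combination (K j l) ^ 2 * hc
    simp only [this, Finset.sum_add_distrib, Finset.sum_sub_distrib, ← Finset.mul_sum, hsum, hd]
    ring
  have hle : ∀ i j, (K i j) ^ 2 ≤ 1 / N ^ 2 := by
    intro i j
    have h1 : 0 ≤ ∑ l, (K i l - 1 * K j l) ^ 2 := Finset.sum_nonneg fun _ _ => sq_nonneg _
    have h2 : 0 ≤ ∑ l, (K i l - (-1) * K j l) ^ 2 := Finset.sum_nonneg fun _ _ => sq_nonneg _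
    rw [hexp _ _ _ (by norm_num)] at h1 h2
    have : |K i j| ≤ 1 / N := by
      rw [abs_le]
      constructor <;> field_simp at h1 h2 ⊢ <;> linarith
    rw [← sq_abs]
    calc |K i j| ^ 2 ≤ (1 / N) ^ 2 := by gcongr
      _ = 1 / N ^ 2 := by ring
  have heq : ∀ i j, (K i j) ^ 2 = 1 / N ^ 2 := by
    intro i j
    have h1 : ∑ l, (K i l) ^ 2 = ∑ _l : n, 1 / N ^ 2 := by
      rw [Finset.sum_const, Finset.card_univ, nsmul_eq_mul, ← hN]
      have := hsum i i
      simp only [← sq, hd] at this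
      rw [this]
      field_simp
    exact (Finset.sum_eq_sum_iff_of_le fun l _ => hle i l).mp h1 j (Finset.mem_univ j)
  have hε : ∀ i j, (N * K i j) ^ 2 = 1 := by
    intro i j
    rw [mul_pow, heq]
    field_simp
  refine ⟨fun i => N * K i o, fun i => by simpa using hε i o, fun i j => ?_⟩
  have hrow : ∑ l, (K i l - N * K i o * K o l) ^ 2 = 0 := by
    rw [hexp _ _ _ (hε i o)]
    have := heq i o
    field_simp at this ⊢
    linarith
  have := (Finset.sum_eq_zero_iff_of_nonneg fun _ _ => sq_nonneg _).mp hrow j (Finset.mem_univ j)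
  rw [sq_eq_zero_iff, sub_eq_zero] at this
  rw [this, hs.apply j o]
  field_simp

variable {d : ℕ}

lemma exists_signs_of_frameMatrix_eq (hd : 1 ≤ d) {z : Fin (d + 1) → Sph d}
    (h : frameMatrix (fun i => (z i : EuclideanSpace ℝ (Fin d))) =
      (((d + 1 : ℕ) : ℝ) / d) • (1 : Matrix (Fin d) (Fin d) ℝ)) :
    ∃ ε : Fin (d + 1) → ℝ, (∀ i, ε i = 1 ∨ ε i = -1) ∧ ∀ i j, i ≠ j →
      inner ℝ (z i : EuclideanSpace ℝ (Fin d)) (z j) = -(ε i * ε j) / d := by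
  have hd0 : (0 : ℝ) < d := by positivity
  set c : ℝ := ((d + 1 : ℕ) : ℝ) / d with hc
  have hc0 : c ≠ 0 := by positivity
  set G := gram ℝ (fun i => (z i : EuclideanSpace ℝ (Fin d))) with hG
  have hGG : G * G = c • G := gram_mul_gram_of_frameMatrix_eq h
  have hGs : G.IsSymm := by
    ext i j
    exact real_inner_comm (z i : EuclideanSpace ℝ (Fin d)) (z j)
  have hGd : ∀ i, G i i = 1 := fun i => inner_self_sph _
  have hs : (1 - c⁻¹ • G).IsSymm := isSymm_one.sub (hGs.smul _)
  have hi : (1 - c⁻¹ • G) * (1 - c⁻¹ • G) = 1 - c⁻¹ • G := by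
    simp only [Matrix.sub_mul, Matrix.mul_sub, Matrix.smul_mul, Matrix.mul_smul, Matrix.one_mul,
      Matrix.mul_one, hGG, smul_smul]
    rw [inv_mul_cancel₀ hc0]
    simp
  have hdiag : ∀ i, (1 - c⁻¹ • G) i i = 1 / Fintype.card (Fin (d + 1)) := by
    intro i
    rw [Matrix.sub_apply, one_apply_eq, Matrix.smul_apply, hGd, Fintype.card_fin, hc]
    push_cast
    rw [smul_eq_mul, mul_one, inv_div]
    field_simp
    ring
  obtain ⟨ε, hε, hK⟩ := exists_signs_of_idempotent hs hi hdiag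
  refine ⟨ε, hε, fun i j hij => ?_⟩
  have h1 := hK i j
  rw [Matrix.sub_apply, one_apply_ne hij, Matrix.smul_apply, smul_eq_mul, zero_sub,
    Fintype.card_fin] at h1
  have h2 : G i j = c * -(-(c⁻¹ * G i j)) := by field_simp
  change G i j = _
  rw [h2, h1, hc]
  field_simp

lemma sign_sq {x : ℝ} (h : x = 1 ∨ x = -1) : x * x = 1 := by
  rcases h with rfl | rfl <;> norm_num

/-- A tight frame of `d + 1` unit vectors consists of the vertices of a regular simplex, up to
signs. -/
lemma exists_eqUpToSigns_of_frameMatrix_eq (hd : 1 ≤ d) {z : Fin (d + 1) → Sph d}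
    (h : frameMatrix (fun i => (z i : EuclideanSpace ℝ (Fin d))) =
      (((d + 1 : ℕ) : ℝ) / d) • (1 : Matrix (Fin d) (Fin d) ℝ)) :
    ∃ w : Fin (d + 1) → Sph d, HasSimplexGram w ∧ EqUpToSigns z w := by
  obtain ⟨ε, hε, hG⟩ := exists_signs_of_frameMatrix_eq hd h
  let w : Fin (d + 1) → Sph d := fun i => if ε i = 1 then z i else -z i
  have hw : ∀ i, (w i : EuclideanSpace ℝ (Fin d)) = ε i • (z i : EuclideanSpace ℝ (Fin d)) := by
    intro i
    by_cases h1 : ε i = 1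
    · simp [w, h1]
    · simp [w, (hε i).resolve_left h1]
      norm_num
  refine ⟨w, fun i j hij => ?_, fun i => ?_⟩
  · rw [hw, hw, inner_smul_left, inner_smul_right, hG i j hij, conj_trivial]
    linear_combination (-(ε j * ε j) / d) * sign_sq (hε i) - 1 / d * sign_sq (hε j)
  · by_cases h1 : ε i = 1
    · left; simp [w, h1]
    · right; simp [w, h1]

/-- A tight frame of `d + 1` unit vectors whose sum is zero consists of the vertices of a regular
simplex. -/
lemma hasSimplexGram_of_frameMatrix_eq (hd : 1 ≤ d) {z : Fin (d + 1) → Sph d}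
    (h : frameMatrix (fun i => (z i : EuclideanSpace ℝ (Fin d))) =
      (((d + 1 : ℕ) : ℝ) / d) • (1 : Matrix (Fin d) (Fin d) ℝ))
    (h0 : ∑ i, (z i : EuclideanSpace ℝ (Fin d)) = 0) : HasSimplexGram z := by
  have hd0 : (0 : ℝ) < d := by positivity
  obtain ⟨ε, hε, hG⟩ := exists_signs_of_frameMatrix_eq hd h
  have h1 : ∀ i, ε i * ∑ j, ε j = d + 1 := by
    intro i
    have h2 := congrArg (fun v => inner ℝ (z i : EuclideanSpace ℝ (Fin d)) v) h0
    simp only [inner_sum, inner_zero_right] at h2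
    rw [← Finset.add_sum_erase _ _ (Finset.mem_univ i), inner_self_sph] at h2
    have h3 : ∑ j ∈ univ.erase i, inner ℝ (z i : EuclideanSpace ℝ (Fin d)) (z j) =
        -(ε i * ∑ j ∈ univ.erase i, ε j) / d := by
      rw [Finset.mul_sum, neg_div, Finset.sum_div, ← Finset.sum_neg_distrib]
      exact Finset.sum_congr rfl fun j hj => by
        rw [hG i j (Finset.ne_of_mem_erase hj).symm, neg_div]
    rw [h3] at h2
    rw [← Finset.add_sum_erase _ _ (Finset.mem_univ i), mul_add, sign_sq (hε i)]
    field_simp at h2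
    linarith
  have h4 : ∑ j, ε j ≠ 0 := by
    intro h4
    have := h1 0
    rw [h4, mul_zero] at this
    linarith
  intro i j hij
  rw [hG i j hij, mul_right_cancel₀ h4 ((h1 i).trans (h1 j).symm), sign_sq (hε j)]

end Rigidity

/-! ### Uniqueness of the regular simplex up to rotations -/

section Rotation

variable {d : ℕ}

lemma norm_sum_smul_eq {ι E F : Type*} [Fintype ι] [NormedAddCommGroup E] [InnerProductSpace ℝ E]
    [NormedAddCommGroup F] [InnerProductSpace ℝ F] {z : ι → E} {w : ι → F}
    (h : ∀ i j, inner ℝ (z i) (z j) = inner ℝ (w i) (w j)) (c : ι → ℝ) :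
    ‖∑ i, c i • z i‖ = ‖∑ i, c i • w i‖ := by
  rw [← sq_eq_sq₀ (norm_nonneg _) (norm_nonneg _), ← real_inner_self_eq_norm_sq,
    ← real_inner_self_eq_norm_sq]
  simp only [sum_inner, inner_sum, inner_smul_left, inner_smul_right, h]

/-- The isometry is constructed from the expansion of a vector with respect to the tight frame
`w`. -/
lemma exists_linearIsometryEquiv (hd : 1 ≤ d) {z w : Fin (d + 1) → Sph d} (hz : HasSimplexGram z)
    (hw : HasSimplexGram w) :
    ∃ R : EuclideanSpace ℝ (Fin d) ≃ₗᵢ[ℝ] EuclideanSpace ℝ (Fin d),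
      ∀ i, (z i : EuclideanSpace ℝ (Fin d)) = R (w i) := by
  set c : ℝ := ((d + 1 : ℕ) : ℝ) / d with hc
  have hc0 : c ≠ 0 := by positivity
  have hf := sum_inner_smul_of_frameMatrix_eq (hw.frameMatrix_eq hd)
  have hg : ∀ i j, inner ℝ (z i : EuclideanSpace ℝ (Fin d)) (z j) =
      inner ℝ (w i : EuclideanSpace ℝ (Fin d)) (w j) := fun i j =>
    (gram_apply_of_hasSimplexGram hz i j).trans (gram_apply_of_hasSimplexGram hw i j).symm
  have hx : ∀ x : EuclideanSpace ℝ (Fin d),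
      ∑ i, (c⁻¹ * inner ℝ (w i : EuclideanSpace ℝ (Fin d)) x) •
        (w i : EuclideanSpace ℝ (Fin d)) = x := by
    intro x
    simp only [← smul_smul, ← Finset.smul_sum, hf]
    exact inv_smul_smul₀ hc0 x
  let T : EuclideanSpace ℝ (Fin d) →ₗ[ℝ] EuclideanSpace ℝ (Fin d) :=
    { toFun := fun x => ∑ i, (c⁻¹ * inner ℝ (w i : EuclideanSpace ℝ (Fin d)) x) •
        (z i : EuclideanSpace ℝ (Fin d))
      map_add' := fun x y => by
        simp only [inner_add_right, mul_add, add_smul, Finset.sum_add_distrib]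
      map_smul' := fun a x => by
        simp only [inner_smul_right, mul_left_comm c⁻¹ a, Finset.smul_sum, smul_smul,
          RingHom.id_apply] }
  have hT : ∀ x, ‖T x‖ = ‖x‖ := fun x => (norm_sum_smul_eq hg _).trans (congrArg _ (hx x))
  refine ⟨(⟨T, hT⟩ : _ →ₗᵢ[ℝ] _).toLinearIsometryEquiv rfl, fun j => ?_⟩
  change (z j : EuclideanSpace ℝ (Fin d)) = T (w j)
  let a : Fin (d + 1) → ℝ := fun i => c⁻¹ * inner ℝ (w i : EuclideanSpace ℝ (Fin d)) (w j)
  have h1 := norm_sum_smul_eq hg (fun i => a i - if i = j then 1 else 0)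
  simp only [sub_smul, Finset.sum_sub_distrib, ite_smul, one_smul, zero_smul,
    Finset.sum_ite_eq', Finset.mem_univ, if_true, a, hx, sub_self, norm_zero] at h1
  exact (sub_eq_zero.mp (norm_eq_zero.mp h1)).symm

/-- An isometry that reverses the orientation is corrected by the reflection that exchanges two
of the vertices. -/
lemma HasSimplexGram.eqUpToRotation (hd : 1 ≤ d) {z w : Fin (d + 1) → Sph d}
    (hz : HasSimplexGram z) (hw : HasSimplexGram w) : EqUpToRotation z w := by
  obtain ⟨R, hR⟩ := exists_linearIsometryEquiv hd hz hw
  obtain ⟨e, rfl⟩ : ∃ e, d = e + 1 := ⟨d - 1, by omega⟩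
  have hdet : LinearMap.det (R.toLinearEquiv : EuclideanSpace ℝ (Fin (e + 1)) →ₗ[ℝ] _) = 1 ∨
      LinearMap.det (R.toLinearEquiv : EuclideanSpace ℝ (Fin (e + 1)) →ₗ[ℝ] _) = -1 := by
    have h1 := R.toLinearIsometry.normDet_eq_one
    rw [LinearMap.normDet_eq_abs_det] at h1
    exact eq_or_eq_neg_of_abs_eq h1
  rcases hdet with h1 | h1
  · exact ⟨R, h1, Equiv.refl _, hR⟩
  let v : EuclideanSpace ℝ (Fin (e + 1)) := w 0 - w 1
  have h01 : (0 : Fin (e + 1 + 1)) ≠ 1 := by simp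
  have hv : v ≠ 0 := by
    intro h
    have h2 := hw 0 1 h01
    rw [← sub_eq_zero.mp h, inner_self_sph, eq_div_iff (by positivity)] at h2
    have : (0 : ℝ) < (e + 1 : ℕ) := by positivity
    linarith
  let ρ := (Submodule.span ℝ {v})ᗮ.reflection
  have hρ : LinearMap.det (ρ.toLinearEquiv : EuclideanSpace ℝ (Fin (e + 1)) →ₗ[ℝ] _) = -1 := by
    have := (Submodule.span ℝ {v})ᗮ.det_reflection
    rw [Submodule.orthogonal_orthogonal, finrank_span_singleton hv, pow_one] at this
    exact this
  have hρ0 : ρ (w 0) = w 1 := Submodule.reflection_sub (by simp)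
  have hρ1 : ρ (w 1) = w 0 := by
    rw [← hρ0]
    exact Submodule.reflection_reflection _ _
  have hρi : ∀ i, i ≠ 0 → i ≠ 1 → ρ (w i) = w i := by
    intro i hi0 hi1
    refine Submodule.reflection_mem_subspace_eq_self ?_
    rw [Submodule.mem_orthogonal_singleton_iff_inner_right, inner_sub_left, hw 0 i hi0.symm,
      hw 1 i hi1.symm, sub_self]
  refine ⟨ρ.trans R, ?_, Equiv.swap 0 1, fun i => ?_⟩
  · have : ((ρ.trans R).toLinearEquiv : EuclideanSpace ℝ (Fin (e + 1)) →ₗ[ℝ] _) =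
        (R.toLinearEquiv : EuclideanSpace ℝ (Fin (e + 1)) →ₗ[ℝ] EuclideanSpace ℝ (Fin (e + 1))) ∘ₗ
          (ρ.toLinearEquiv : EuclideanSpace ℝ (Fin (e + 1)) →ₗ[ℝ] _) := rfl
    rw [IsRotation, this, LinearMap.det_comp, h1, hρ]
    norm_num
  · rw [hR i, LinearIsometryEquiv.trans_apply]
    congr 1
    by_cases hi0 : i = 0
    · rw [hi0, Equiv.swap_apply_left, hρ1]
    by_cases hi1 : i = 1
    · rw [hi1, Equiv.swap_apply_right, hρ0]
    · rw [Equiv.swap_apply_of_ne_of_ne hi0 hi1, hρi i hi0 hi1]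

end Rotation

/-! ### Energies as power sums -/

section PowerSums

/-- The power mean inequality, with its equality case. -/
lemma sum_rpow_le {ι : Type*} [Fintype ι] [Nonempty ι] {a : ι → ℝ} (ha : ∀ i, 0 ≤ a i) {p α : ℝ}
    (hp0 : 0 < p) (hp1 : p ≤ 1) (hsum : ∑ i, a i ≤ Fintype.card ι * α) :
    ∑ i, a i ^ p ≤ Fintype.card ι * α ^ p ∧
      (∑ i, a i ^ p = Fintype.card ι * α ^ p →
        ∑ i, a i = Fintype.card ι * α ∧ (p < 1 → ∀ i, a i = α)) := by
  have hM : (0 : ℝ) < Fintype.card ι := by exact_mod_cast Fintype.card_pos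
  set M : ℝ := (Fintype.card ι : ℝ) with hMdef
  have hw : ∑ _i : ι, M⁻¹ = 1 := by
    rw [Finset.sum_const, Finset.card_univ, nsmul_eq_mul, ← hMdef, mul_inv_cancel₀ hM.ne']
  have hJ := (Real.concaveOn_rpow hp0.le hp1).le_map_sum (t := univ) (w := fun _ : ι => M⁻¹)
    (p := a) (fun _ _ => by positivity) hw (fun i _ => ha i)
  simp only [smul_eq_mul, ← Finset.mul_sum] at hJ
  have hmean0 : 0 ≤ M⁻¹ * ∑ i, a i :=
    mul_nonneg (by positivity) (Finset.sum_nonneg fun i _ => ha i)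
  have hmean : M⁻¹ * ∑ i, a i ≤ α := by
    rw [inv_mul_le_iff₀ hM]; exact hsum
  have hpow : (M⁻¹ * ∑ i, a i) ^ p ≤ α ^ p := Real.rpow_le_rpow hmean0 hmean hp0.le
  refine ⟨?_, fun heq => ?_⟩
  · rw [← inv_mul_le_iff₀ hM]
    exact hJ.trans hpow
  · have h1 : M⁻¹ * ∑ i, a i ^ p = α ^ p := by
      rw [heq, inv_mul_cancel_left₀ hM.ne']
    have h2 : (M⁻¹ * ∑ i, a i) ^ p = α ^ p := le_antisymm hpow (h1 ▸ hJ)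
    have h3 : M⁻¹ * ∑ i, a i = α :=
      (Real.rpow_left_inj hmean0 (hmean0.trans hmean) hp0.ne').mp h2
    refine ⟨by rw [← h3, mul_inv_cancel_left₀ hM.ne'], fun hp => ?_⟩
    have h4 := ((Real.strictConcaveOn_rpow hp0 hp).map_sum_eq_iff (t := univ)
      (w := fun _ : ι => M⁻¹) (p := a) (fun _ _ => by positivity) hw (fun i _ => ha i)).mp (by
        simp only [smul_eq_mul, ← Finset.mul_sum]
        rw [h1, h2])
    intro i
    rw [h4 i (Finset.mem_univ i), ← Finset.smul_sum]
    exact h3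

/-- Let the energy of `z` be a sum of powers `f z e ^ p` with `0 < p ≤ 1`, up to a constant factor,
and let some `w` maximize the sum of the numbers `f z e`, with all `f w e` equal to `α`. By
concavity, `w` maximizes the energy. -/
lemma isMaxOn_of_forall_eq {X ι : Type*} [Fintype ι] [Nonempty ι] {f : X → ι → ℝ}
    (hf : ∀ z e, 0 ≤ f z e) {p α C : ℝ} (hp0 : 0 < p) (hp1 : p ≤ 1) (hC : 0 < C)
    (hsum : ∀ z, ∑ e, f z e ≤ Fintype.card ι * α) {E : X → ℝ}
    (hE : ∀ z, E z = C * ∑ e, f z e ^ p) {w : X} (hw : ∀ e, f w e = α) :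
    IsMaxOn E Set.univ w := by
  intro z _
  simp only [Set.mem_ofPred_eq, hE, hw, Finset.sum_const, Finset.card_univ, nsmul_eq_mul]
  exact mul_le_mul_of_nonneg_left (sum_rpow_le (hf z) hp0 hp1 (hsum z)).1 hC.le

/-- In the situation of `isMaxOn_of_forall_eq`, all maximizers of the energy also maximize the sum
of the numbers `f z e`, and these numbers are all equal if `p < 1`. -/
lemma sum_eq_of_isMaxOn {X ι : Type*} [Fintype ι] [Nonempty ι] {f : X → ι → ℝ}
    (hf : ∀ z e, 0 ≤ f z e) {p α C : ℝ} (hp0 : 0 < p) (hp1 : p ≤ 1) (hC : 0 < C)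
    (hsum : ∀ z, ∑ e, f z e ≤ Fintype.card ι * α) {E : X → ℝ}
    (hE : ∀ z, E z = C * ∑ e, f z e ^ p) {w : X} (hw : ∀ e, f w e = α) {z : X}
    (hz : IsMaxOn E Set.univ z) :
    ∑ e, f z e = Fintype.card ι * α ∧ (p < 1 → ∀ e, f z e = α) := by
  have h := sum_rpow_le (hf z) hp0 hp1 (hsum z)
  refine h.2 (le_antisymm h.1 ?_)
  have h1 : E w ≤ E z := hz (Set.mem_univ w)
  simp only [hE, hw, Finset.sum_const, Finset.card_univ, nsmul_eq_mul] at h1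
  exact le_of_mul_le_mul_left h1 hC

end PowerSums

section Kernels

open Matrix

variable {d N : ℕ}

/-- The squared volume of the parallelepiped spanned by the points with indices `e`. -/
noncomputable def gramDet {k : ℕ} (z : Fin N → Sph d) (e : Fin k ↪ Fin N) : ℝ :=
  ((gram ℝ fun i => (z i : EuclideanSpace ℝ (Fin d))).submatrix e e).det

/-- The squared volume of the simplex whose vertices are the points with indices `e`, up to a
constant factor. -/
noncomputable def diffDet {m : ℕ} (z : Fin N → Sph d) (e : Fin (m + 1) ↪ Fin N) : ℝ :=
  (diffMatrix ((gram ℝ fun i => (z i : EuclideanSpace ℝ (Fin d))).submatrix e e)).det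

lemma gramDet_nonneg {k : ℕ} (z : Fin N → Sph d) (e : Fin k ↪ Fin N) : 0 ≤ gramDet z e :=
  (posSemidef_gram ℝ fun i => (z (e i) : EuclideanSpace ℝ (Fin d))).det_nonneg

lemma diffDet_nonneg {m : ℕ} (z : Fin N → Sph d) (e : Fin (m + 1) ↪ Fin N) : 0 ≤ diffDet z e := by
  have := diffMatrix_gram fun i => (z (e i) : EuclideanSpace ℝ (Fin d))
  change 0 ≤ (diffMatrix (gram ℝ fun i => (z (e i) : EuclideanSpace ℝ (Fin d)))).det
  rw [this]
  exact (posSemidef_gram ℝ _).det_nonneg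

lemma det_diffMatrix_submatrix_eq_zero {n : Type*} (A : Matrix n n ℝ) {m : ℕ}
    (j : Fin (m + 1) → n) (hj : ¬ Function.Injective j) :
    (diffMatrix (A.submatrix j j)).det = 0 := by
  rw [Function.not_injective_iff] at hj
  obtain ⟨a, b, hab, hne⟩ := hj
  wlog hlt : a < b generalizing a b
  · exact this b a hab.symm hne.symm (lt_of_le_of_ne (not_lt.mp hlt) hne.symm)
  obtain ⟨b, rfl⟩ := Fin.exists_succ_eq_of_ne_zero (Fin.ne_zero_of_lt hlt)
  refine Fin.cases (fun hab _ _ => ?_) (fun a hab hne _ => ?_) a hab hne hlt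
  · refine det_eq_zero_of_row_eq_zero b fun s => ?_
    simp [diffMatrix, hab]
  · refine det_zero_of_row_eq (i := a) (j := b) (fun h => hne (by rw [h])) ?_
    ext s
    simp [diffMatrix, hab]

lemma energyV_eq (k : ℕ) {s : ℝ} (hs : 0 < s) (z : Fin N → Sph d) :
    energyV k s z = 1 / (N : ℝ) ^ k * ∑ e : Fin k ↪ Fin N, gramDet z e ^ (s / 2) := by
  have h : ∀ j : Fin k → Fin N, volV (fun i => z (j i)) ^ s =
      ((gram ℝ fun i => (z i : EuclideanSpace ℝ (Fin d))).submatrix j j).det ^ (s / 2) := by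
    intro j
    rw [volV_eq, Real.sqrt_eq_rpow, ← Real.rpow_mul (posSemidef_gram ℝ _).det_nonneg,
      one_div_mul_eq_div]
    rfl
  rw [energyV, discreteEnergy]
  simp only [h]
  rw [sum_eq_sum_embedding]
  · rfl
  · intro j hj
    rw [det_submatrix_eq_zero_of_not_injective _ _ hj, Real.zero_rpow (by positivity)]

lemma energyA_eq (m : ℕ) {s : ℝ} (hs : 0 < s) (z : Fin N → Sph d) :
    energyA (m + 1) s z =
      1 / (N : ℝ) ^ (m + 1) * (MeasureTheory.volume (cornerSimplex m)).toReal ^ s *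
        ∑ e : Fin (m + 1) ↪ Fin N, diffDet z e ^ (s / 2) := by
  have h : ∀ j : Fin (m + 1) → Fin N, volA (fun i => z (j i)) ^ s =
      (MeasureTheory.volume (cornerSimplex m)).toReal ^ s *
      (diffMatrix ((gram ℝ fun i => (z i : EuclideanSpace ℝ (Fin d))).submatrix j j)).det
        ^ (s / 2) := by
    intro j
    rw [volA_eq, Real.mul_rpow (volume_cornerSimplex_pos m).le (Real.sqrt_nonneg _),
      Real.sqrt_eq_rpow, ← Real.rpow_mul, one_div_mul_eq_div]
    · rfl
    · rw [diffMatrix_gram]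
      exact (posSemidef_gram ℝ _).det_nonneg
  rw [energyA, discreteEnergy]
  simp only [h]
  rw [← Finset.mul_sum, mul_assoc, sum_eq_sum_embedding]
  · rfl
  · intro j hj
    rw [det_diffMatrix_submatrix_eq_zero _ _ hj, Real.zero_rpow (by positivity)]

lemma sum_gramDet (k : ℕ) (z : Fin N → Sph d) :
    ∑ e : Fin k ↪ Fin N, gramDet z e =
      minorSum k (gram ℝ fun i => (z i : EuclideanSpace ℝ (Fin d))) :=
  (minorSum_eq_sum_embedding _ _).symm

/-- The points, translated by their center of mass. -/
noncomputable def centered (z : Fin N → Sph d) (i : Fin N) : EuclideanSpace ℝ (Fin d) :=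
  z i - (N : ℝ)⁻¹ • ∑ l, (z l : EuclideanSpace ℝ (Fin d))

lemma sum_centered (hN : N ≠ 0) (z : Fin N → Sph d) : ∑ i, centered z i = 0 := by
  have : (N : ℝ) ≠ 0 := by exact_mod_cast hN
  simp only [centered, Finset.sum_sub_distrib, Finset.sum_const, Finset.card_univ,
    Fintype.card_fin, ← Nat.cast_smul_eq_nsmul ℝ, smul_inv_smul₀ this, sub_self]

lemma sum_norm_centered_sq (hN : N ≠ 0) (z : Fin N → Sph d) :
    ∑ i, ‖centered z i‖ ^ 2 =
      N - (N : ℝ)⁻¹ * ‖∑ i, (z i : EuclideanSpace ℝ (Fin d))‖ ^ 2 := by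
  have : (N : ℝ) ≠ 0 := by exact_mod_cast hN
  simp only [centered, norm_sub_sq_real, inner_smul_right, norm_smul, Finset.sum_add_distrib,
    Finset.sum_sub_distrib, sum_norm_sq_sph, ← Finset.mul_sum, ← sum_inner,
    real_inner_self_eq_norm_sq, Finset.sum_const, Finset.card_univ, Fintype.card_fin,
    nsmul_eq_mul, mul_pow, norm_inv, RCLike.norm_natCast]
  field_simp
  ring

lemma sum_diffDet (hN : N ≠ 0) (m : ℕ) (z : Fin N → Sph d) :
    ∑ e : Fin (m + 1) ↪ Fin N, diffDet z e =
      (m + 1) * (N * minorSum m (gram ℝ (centered z))) := by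
  have h1 : ∀ i, ∑ j, gram ℝ (centered z) i j = 0 := by
    intro i
    simp only [gram_apply]
    rw [← inner_sum, sum_centered hN, inner_zero_right]
  have h2 := sum_det_diffMatrix (m := m) (gram ℝ (centered z)) h1
  rw [Fintype.card_fin] at h2
  rw [← h2, sum_eq_sum_embedding _ (det_diffMatrix_submatrix_eq_zero _)]
  refine Finset.sum_congr rfl fun e _ => ?_
  have h3 := diffMatrix_gram fun i => (z (e i) : EuclideanSpace ℝ (Fin d))
  have h4 := diffMatrix_gram fun i => centered z (e i)
  simp only [centered, sub_sub_sub_cancel_right] at h4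
  exact congrArg det (h3.trans h4.symm)

lemma centered_eq {z : Fin N → Sph d} (h : ∑ i, (z i : EuclideanSpace ℝ (Fin d)) = 0) :
    centered z = fun i => (z i : EuclideanSpace ℝ (Fin d)) := by
  ext1 i
  simp [centered, h]

/-- The bound for the sum of the squared volumes of simplices. -/
lemma sum_diffDet_le (hN : N ≠ 0) {m : ℕ} (hm : m ≤ d) (z : Fin N → Sph d) :
    ∑ e : Fin (m + 1) ↪ Fin N, diffDet z e ≤
      (m + 1) * (N * (d.descFactorial m * ((N : ℝ) / d) ^ m)) := by
  rw [sum_diffDet hN]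
  have h1 := minorSum_gram_le (centered z) hm
  rw [sum_norm_centered_sq hN] at h1
  have h0 : 0 ≤ ∑ i, ‖centered z i‖ ^ 2 := Finset.sum_nonneg fun _ _ => sq_nonneg _
  rw [sum_norm_centered_sq hN] at h0
  have h2 : 0 ≤ (N : ℝ)⁻¹ * ‖∑ i, (z i : EuclideanSpace ℝ (Fin d))‖ ^ 2 := by positivity
  refine mul_le_mul_of_nonneg_left (mul_le_mul_of_nonneg_left (h1.trans ?_) (by positivity))
    (by positivity)
  gcongr
  linarith

lemma sum_eq_zero_of_sum_diffDet_eq (hN : N ≠ 0) {m : ℕ} (hm1 : 1 ≤ m) (hm : m ≤ d)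
    {z : Fin N → Sph d} (h : ∑ e : Fin (m + 1) ↪ Fin N, diffDet z e =
      (m + 1) * (N * (d.descFactorial m * ((N : ℝ) / d) ^ m))) :
    ∑ i, (z i : EuclideanSpace ℝ (Fin d)) = 0 := by
  have hN0 : (0 : ℝ) < N := by positivity
  have hd0 : (0 : ℝ) < d := by exact_mod_cast (by omega : 0 < d)
  rw [sum_diffDet hN] at h
  have h1 := minorSum_gram_le (centered z) hm
  rw [mul_left_cancel₀ hN0.ne' (mul_left_cancel₀ (by positivity) h)] at h1
  have h2 := le_of_mul_le_mul_left h1 (by exact_mod_cast Nat.descFactorial_pos.mpr hm)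
  have h3 := le_of_pow_le_pow_left₀ (by omega) (by positivity) h2
  rw [div_le_div_iff_of_pos_right hd0, sum_norm_centered_sq hN] at h3
  have h4 : (N : ℝ)⁻¹ * ‖∑ i, (z i : EuclideanSpace ℝ (Fin d))‖ ^ 2 ≤ 0 := by linarith
  have h5 : ‖∑ i, (z i : EuclideanSpace ℝ (Fin d))‖ ^ 2 ≤ 0 :=
    nonpos_of_mul_nonpos_right h4 (by positivity)
  exact norm_eq_zero.mp (pow_eq_zero_iff two_ne_zero |>.mp (le_antisymm h5 (sq_nonneg _)))

end Kernels

/-! ### Maximizers -/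

section Maximizers

open Matrix

variable {d : ℕ}

lemma HasSimplexGram.submatrix_gram {z : Fin (d + 1) → Sph d} (hz : HasSimplexGram z) {k : ℕ}
    (e : Fin k ↪ Fin (d + 1)) :
    (gram ℝ fun i => (z i : EuclideanSpace ℝ (Fin d))).submatrix e e =
      of fun r s => if r = s then 1 else -1 / (d : ℝ) := by
  ext r s
  rw [submatrix_apply, gram_apply_of_hasSimplexGram hz]
  simp [e.injective.eq_iff]

/-- The common value of `gramDet` for all `k`-tuples of vertices of a regular simplex. -/
noncomputable def simplexGramDet (d k : ℕ) : ℝ :=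
  (of fun r s : Fin k => if r = s then 1 else -1 / (d : ℝ)).det

/-- The common value of `diffDet` for all `(m + 1)`-tuples of vertices of a regular simplex. -/
noncomputable def simplexDiffDet (d m : ℕ) : ℝ :=
  (diffMatrix (of fun r s : Fin (m + 1) => if r = s then 1 else -1 / (d : ℝ))).det

lemma HasSimplexGram.gramDet_eq {z : Fin (d + 1) → Sph d} (hz : HasSimplexGram z) {k : ℕ}
    (e : Fin k ↪ Fin (d + 1)) : gramDet z e = simplexGramDet d k := by
  rw [gramDet, hz.submatrix_gram, simplexGramDet]

lemma HasSimplexGram.diffDet_eq {z : Fin (d + 1) → Sph d} (hz : HasSimplexGram z) {m : ℕ}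
    (e : Fin (m + 1) ↪ Fin (d + 1)) : diffDet z e = simplexDiffDet d m := by
  rw [diffDet, hz.submatrix_gram, simplexDiffDet]

lemma HasSimplexGram.sum_eq_zero (hd : 1 ≤ d) {z : Fin (d + 1) → Sph d} (hz : HasSimplexGram z) :
    ∑ i, (z i : EuclideanSpace ℝ (Fin d)) = 0 := by
  have hd0 : (d : ℝ) ≠ 0 := by positivity
  refine inner_self_eq_zero (𝕜 := ℝ).mp ?_
  rw [sum_inner]
  refine Finset.sum_eq_zero fun i _ => ?_
  rw [inner_sum, ← Finset.add_sum_erase _ _ (Finset.mem_univ i), inner_self_sph,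
    Finset.sum_congr rfl fun j hj => hz i j (Finset.ne_of_mem_erase hj).symm]
  simp
  field_simp
  simp

lemma card_mul_simplexGramDet (hd : 1 ≤ d) (k : ℕ) :
    Fintype.card (Fin k ↪ Fin (d + 1)) * simplexGramDet d k =
      d.descFactorial k * (((d + 1 : ℕ) : ℝ) / d) ^ k := by
  obtain ⟨z, hz⟩ := exists_hasSimplexGram hd
  rw [← minorSum_gram_of_frameMatrix_eq (hz.frameMatrix_eq hd), ← sum_gramDet]
  simp only [hz.gramDet_eq, Finset.sum_const, Finset.card_univ, nsmul_eq_mul]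

lemma card_mul_simplexDiffDet (hd : 1 ≤ d) (m : ℕ) :
    Fintype.card (Fin (m + 1) ↪ Fin (d + 1)) * simplexDiffDet d m =
      (m + 1) * ((d + 1 : ℕ) * (d.descFactorial m * (((d + 1 : ℕ) : ℝ) / d) ^ m)) := by
  obtain ⟨z, hz⟩ := exists_hasSimplexGram hd
  rw [← minorSum_gram_of_frameMatrix_eq (hz.frameMatrix_eq hd), ← centered_eq (hz.sum_eq_zero hd),
    ← sum_diffDet (Nat.succ_ne_zero d)]
  simp only [hz.diffDet_eq, Finset.sum_const, Finset.card_univ, nsmul_eq_mul]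

lemma nonempty_embedding {k : ℕ} (hk : k ≤ d + 1) : Nonempty (Fin k ↪ Fin (d + 1)) :=
  ⟨Fin.castLEEmb hk⟩

lemma sum_gramDet_le (hd : 1 ≤ d) {k : ℕ} (hk : k ≤ d) (z : Fin (d + 1) → Sph d) :
    ∑ e : Fin k ↪ Fin (d + 1), gramDet z e ≤
      Fintype.card (Fin k ↪ Fin (d + 1)) * simplexGramDet d k := by
  rw [card_mul_simplexGramDet hd, sum_gramDet]
  have := minorSum_gram_le (fun i => (z i : EuclideanSpace ℝ (Fin d))) hk
  rwa [sum_norm_sq_sph] at this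

lemma EqUpToSigns.gramDet_eq {z w : Fin (d + 1) → Sph d} (h : EqUpToSigns z w) {k : ℕ}
    (e : Fin k ↪ Fin (d + 1)) : gramDet z e = gramDet w e := by
  have h1 : ∀ i, ∃ c : ℝ, (c = 1 ∨ c = -1) ∧
      (z i : EuclideanSpace ℝ (Fin d)) = c • (w i : EuclideanSpace ℝ (Fin d)) := by
    intro i
    rcases h i with h | h
    · exact ⟨1, Or.inl rfl, by rw [h, one_smul]⟩
    · exact ⟨-1, Or.inr rfl, by rw [h]; simp⟩
  choose c hc hz using h1
  have h2 : (gram ℝ fun i => (z i : EuclideanSpace ℝ (Fin d))).submatrix e e =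
      diagonal (fun r => c (e r)) *
        ((gram ℝ fun i => (w i : EuclideanSpace ℝ (Fin d))).submatrix e e) *
        diagonal (fun r => c (e r)) := by
    ext r s
    rw [mul_diagonal, diagonal_mul]
    simp only [submatrix_apply, gram_apply, hz, inner_smul_left, inner_smul_right, conj_trivial]
    ring
  have h3 : (∏ r, c (e r)) * ∏ r, c (e r) = 1 := by
    rw [← Finset.prod_mul_distrib]
    exact Finset.prod_eq_one fun r _ => sign_sq (hc _)
  rw [gramDet, h2, det_mul, det_mul, det_diagonal]
  change _ * gramDet w e * _ = gramDet w e
  linear_combination gramDet w e * h3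

lemma isMaxOn_energyV_iff {k : ℕ} (hk2 : 2 ≤ k) (hk : k ≤ d) {s : ℝ} (hs0 : 0 < s) (hs2 : s ≤ 2)
    (z : Fin (d + 1) → Sph d) :
    IsMaxOn (energyV k s) Set.univ z ↔
      ∃ w : Fin (d + 1) → Sph d, HasSimplexGram w ∧ EqUpToSigns z w := by
  have hd : 1 ≤ d := by omega
  have hne := nonempty_embedding (d := d) (k := k) (by omega)
  have hC : (0 : ℝ) < 1 / ((d + 1 : ℕ) : ℝ) ^ k := by positivity
  refine ⟨fun h => ?_, fun ⟨w, hw, hzw⟩ => ?_⟩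
  · obtain ⟨w, hw⟩ := exists_hasSimplexGram hd
    have h1 := (sum_eq_of_isMaxOn gramDet_nonneg (by linarith) (by linarith) hC
      (sum_gramDet_le hd hk) (energyV_eq k hs0) hw.gramDet_eq h).1
    rw [card_mul_simplexGramDet hd, sum_gramDet] at h1
    have h2 := frameMatrix_eq_of_le_minorSum (fun i => (z i : EuclideanSpace ℝ (Fin d))) hk2 hk
      (by rw [sum_norm_sq_sph]; positivity) (by rw [sum_norm_sq_sph]; exact h1.ge)
    rw [sum_norm_sq_sph] at h2
    exact exists_eqUpToSigns_of_frameMatrix_eq hd h2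
  · exact isMaxOn_of_forall_eq gramDet_nonneg (by linarith) (by linarith) hC
      (sum_gramDet_le hd hk) (energyV_eq k hs0)
      fun e => (hzw.gramDet_eq e).trans (hw.gramDet_eq e)

lemma EqUpToRotation.eqUpToRotationAndSigns {N : ℕ} {z w z' w' : Fin N → Sph d}
    (h : EqUpToRotation z' w') (hz : EqUpToSigns z z') (hw : EqUpToSigns w w') :
    EqUpToRotationAndSigns z w := by
  obtain ⟨R, hR, π, hπ⟩ := h
  refine ⟨fun i => ⟨R (w (π i)), by simp⟩, fun i => ?_, R, hR, π, fun i => rfl⟩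
  have h1 : ∀ a b : Sph d, (a : EuclideanSpace ℝ (Fin d)) = b → a = b := fun _ _ => Subtype.ext
  rcases hz i with h | h <;> rcases hw (π i) with h' | h'
  · left; apply h1; simp [h, h', hπ]
  · right; apply h1; simp [h, h', hπ]
  · right; apply h1; simp [h, h', hπ]
  · left; apply h1; simp [h, h', hπ]

lemma HasSimplexGram.isMaxOn_energyA (hd : 1 ≤ d) {m : ℕ} (hm : m ≤ d) {s : ℝ} (hs0 : 0 < s)
    (hs2 : s ≤ 2) {z : Fin (d + 1) → Sph d} (hz : HasSimplexGram z) :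
    IsMaxOn (energyA (m + 1) s) Set.univ z := by
  have hne := nonempty_embedding (d := d) (k := m + 1) (by omega)
  have hv := volume_cornerSimplex_pos m
  refine isMaxOn_of_forall_eq diffDet_nonneg (by linarith) (by linarith) ?_ (fun w => ?_)
    (energyA_eq m hs0) hz.diffDet_eq
  · positivity
  · rw [card_mul_simplexDiffDet hd]
    exact sum_diffDet_le (Nat.succ_ne_zero d) hm w

lemma diffDet_one {N : ℕ} (z : Fin N → Sph d) (e : Fin (1 + 1) ↪ Fin N) :
    diffDet z e = 2 - 2 * inner ℝ (z (e 0) : EuclideanSpace ℝ (Fin d)) (z (e 1)) := by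
  rw [diffDet, det_unique]
  simp only [diffMatrix, of_apply, submatrix_apply, gram_apply]
  have h : (Fin.succ default : Fin (1 + 1)) = 1 := rfl
  rw [h, inner_self_sph, inner_self_sph, real_inner_comm (z (e 0) : EuclideanSpace ℝ (Fin d))]
  ring

/-- In dimensions one and two, the inner products of `d + 1` unit vectors with sum zero are the
unique solution of a system of linear equations. -/
lemma hasSimplexGram_of_sum_eq_zero (hd1 : 1 ≤ d) (hd2 : d ≤ 2) {z : Fin (d + 1) → Sph d}
    (h : ∑ i, (z i : EuclideanSpace ℝ (Fin d)) = 0) : HasSimplexGram z := by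
  have h1 : ∀ i, ∑ j, inner ℝ (z i : EuclideanSpace ℝ (Fin d)) (z j) = 0 := by
    intro i
    rw [← inner_sum, h, inner_zero_right]
  have hc : ∀ i j, inner ℝ (z i : EuclideanSpace ℝ (Fin d)) (z j) =
      inner ℝ (z j : EuclideanSpace ℝ (Fin d)) (z i) := fun i j => real_inner_comm _ _
  interval_cases d
  · have h2 := (Fin.sum_univ_two _).symm.trans (h1 0)
    have h3 := hc 0 1
    simp only [inner_self_sph] at h2
    intro i j hij
    fin_cases i <;> fin_cases j <;> simp at hij ⊢ <;> linarith
  · have h2 := (Fin.sum_univ_three _).symm.trans (h1 0)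
    have h3 := (Fin.sum_univ_three _).symm.trans (h1 1)
    have h4 := (Fin.sum_univ_three _).symm.trans (h1 2)
    have h5 := hc 0 1
    have h6 := hc 0 2
    have h7 := hc 1 2
    simp only [inner_self_sph] at h2 h3 h4
    intro i j hij
    fin_cases i <;> fin_cases j <;> simp at hij ⊢ <;> linarith

lemma hasSimplexGram_of_isMaxOn_energyA {m : ℕ} (hm1 : 1 ≤ m) (hm : m ≤ d) {s : ℝ} (hs0 : 0 < s)
    (hs2 : s ≤ 2) (hex : s < 2 ∨ 2 ≤ m ∨ d ≤ 2) {z : Fin (d + 1) → Sph d}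
    (hz : IsMaxOn (energyA (m + 1) s) Set.univ z) : HasSimplexGram z := by
  have hd : 1 ≤ d := by omega
  have hne := nonempty_embedding (d := d) (k := m + 1) (by omega)
  have hv := volume_cornerSimplex_pos m
  obtain ⟨w, hw⟩ := exists_hasSimplexGram hd
  obtain ⟨h1, h2⟩ := sum_eq_of_isMaxOn diffDet_nonneg (p := s / 2) (by linarith) (by linarith)
    (by positivity) (fun w => by
      rw [card_mul_simplexDiffDet hd]; exact sum_diffDet_le (Nat.succ_ne_zero d) hm w)
    (energyA_eq m hs0) hw.diffDet_eq hz
  rw [card_mul_simplexDiffDet hd] at h1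
  have h0 := sum_eq_zero_of_sum_diffDet_eq (Nat.succ_ne_zero d) hm1 hm h1
  by_cases hm2 : 2 ≤ m
  · rw [sum_diffDet (Nat.succ_ne_zero d), centered_eq h0] at h1
    have h3 := mul_left_cancel₀ (by positivity) (mul_left_cancel₀ (by positivity) h1)
    have h4 := frameMatrix_eq_of_le_minorSum (fun i => (z i : EuclideanSpace ℝ (Fin d))) hm2 hm
      (by rw [sum_norm_sq_sph]; positivity) (by rw [sum_norm_sq_sph]; exact h3.ge)
    rw [sum_norm_sq_sph] at h4
    exact hasSimplexGram_of_frameMatrix_eq hd h4 h0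
  · obtain rfl : m = 1 := by omega
    rcases hex with hs | h | hd2
    · intro i j hij
      -- All distances agree with those of the regular simplex.
      let e : Fin (1 + 1) ↪ Fin (d + 1) := ⟨![i, j], by
        intro a b
        fin_cases a <;> fin_cases b <;> simp [hij, hij.symm]⟩
      have h3 := (h2 (by linarith) e).trans (hw.diffDet_eq e).symm
      rw [diffDet_one, diffDet_one] at h3
      have h4 : inner ℝ (w i : EuclideanSpace ℝ (Fin d)) (w j) = -1 / d := hw i j hij
      change 2 - 2 * inner ℝ (z i : EuclideanSpace ℝ (Fin d)) (z j) =
        2 - 2 * inner ℝ (w i : EuclideanSpace ℝ (Fin d)) (w j) at h3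
      linarith
    · omega
    · exact hasSimplexGram_of_sum_eq_zero hd hd2 h0

end Maximizers
end SimplexEnergy

/-- The first part is about the kernel `V ^ s`, the second about the kernel `A ^ s`. -/
theorem corollary3p2 (d k : ℕ) (hk : 2 ≤ k) (s : ℝ) (hs0 : 0 < s) (hs2 : s ≤ 2) :
    (k ≤ d →
      (∃ z : Fin (d + 1) → SimplexEnergy.Sph d, SimplexEnergy.IsRegularSimplex z) ∧
      (∀ z : Fin (d + 1) → SimplexEnergy.Sph d,
        IsMaxOn (SimplexEnergy.energyV k s) Set.univ z ↔
          ∃ w : Fin (d + 1) → SimplexEnergy.Sph d,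
            SimplexEnergy.IsRegularSimplex w ∧ SimplexEnergy.EqUpToSigns z w) ∧
      (∀ z w : Fin (d + 1) → SimplexEnergy.Sph d,
        IsMaxOn (SimplexEnergy.energyV k s) Set.univ z →
        IsMaxOn (SimplexEnergy.energyV k s) Set.univ w →
          SimplexEnergy.EqUpToRotationAndSigns z w)) ∧
    (k ≤ d + 1 →
      (∃ z : Fin (d + 1) → SimplexEnergy.Sph d, SimplexEnergy.IsRegularSimplex z) ∧
      (∀ z : Fin (d + 1) → SimplexEnergy.Sph d, SimplexEnergy.IsRegularSimplex z →
        IsMaxOn (SimplexEnergy.energyA k s) Set.univ z) ∧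
      (s < 2 ∨ 3 ≤ k ∨ d ≤ 2 →
        (∀ z : Fin (d + 1) → SimplexEnergy.Sph d,
          IsMaxOn (SimplexEnergy.energyA k s) Set.univ z →
            SimplexEnergy.IsRegularSimplex z) ∧
        (∀ z w : Fin (d + 1) → SimplexEnergy.Sph d,
          IsMaxOn (SimplexEnergy.energyA k s) Set.univ z →
          IsMaxOn (SimplexEnergy.energyA k s) Set.univ w →
            SimplexEnergy.EqUpToRotation z w))) := by
  have hex : 1 ≤ d → ∃ z : Fin (d + 1) → SimplexEnergy.Sph d, SimplexEnergy.IsRegularSimplex z := by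
    intro hd
    obtain ⟨z, hz⟩ := SimplexEnergy.exists_hasSimplexGram hd
    exact ⟨z, hz.isRegularSimplex hd⟩
  refine ⟨fun hkd => ?_, fun hkd => ?_⟩
  · have hd : 1 ≤ d := by omega
    refine ⟨hex hd, fun z => ?_, fun z w hz hw => ?_⟩
    · simp only [SimplexEnergy.isRegularSimplex_iff hd]
      exact SimplexEnergy.isMaxOn_energyV_iff hk hkd hs0 hs2 z
    · obtain ⟨z', hz', hzz'⟩ := (SimplexEnergy.isMaxOn_energyV_iff hk hkd hs0 hs2 z).mp hz
      obtain ⟨w', hw', hww'⟩ := (SimplexEnergy.isMaxOn_energyV_iff hk hkd hs0 hs2 w).mp hw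
      exact (hz'.eqUpToRotation hd hw').eqUpToRotationAndSigns hzz' hww'
  · have hd : 1 ≤ d := by omega
    obtain ⟨m, rfl⟩ : ∃ m, k = m + 1 := ⟨k - 1, by omega⟩
    refine ⟨hex hd, fun z hz => ?_, fun hcase => ?_⟩
    · exact ((SimplexEnergy.isRegularSimplex_iff hd).mp hz).isMaxOn_energyA hd (by omega) hs0 hs2
    · have key : ∀ z : Fin (d + 1) → SimplexEnergy.Sph d,
          IsMaxOn (SimplexEnergy.energyA (m + 1) s) Set.univ z → SimplexEnergy.HasSimplexGram z :=
        fun z hz => SimplexEnergy.hasSimplexGram_of_isMaxOn_energyA (by omega) (by omega) hs0 hs2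
          (hcase.imp id (Or.imp (by omega) id)) hz
      exact ⟨fun z hz => (key z hz).isRegularSimplex hd,
        fun z w hz hw => (key z hz).eqUpToRotation hd (key w hw)⟩
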